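/- Let $\lambda:\mathbb{Z}_+\to[0,\infty)$ with $\lambda(0)>0$, and let $\mu_1\ge\mu_2>0$. Let $S(\lambda,\mu_1,\mu_2)$ denote the system of transition rates on $\mathbb{Z}_+^2$ given, for $x=(x_1,x_2)\ne y$, by $$ q(x,y)=\begin{cases}\lambda(x_2), & y=x+e_1,\\ \mu_1, & y=x-e_1+e_2\in\mathbb{Z}_+^2,\\ \mu_2, & y=x-e_2\in\mathbb{Z}_+^2,\\ 0,&\text{otherwise,}\end{cases} $$ where $e_1=(1,0)$ and $e_2=(0,1)$. The system is called stable if the minimal continuous-time Markov process with these rates (which is sent to an additional state at its time of explosion, if any) is ergodic, that is, irreducible and positive recurrent; otherwise it is called unstable. For $n\ge 0$ let $Z_n$ be a random variable on $\{0,1,\dots,n\}$ with $$\operatorname{P}(Z_n=j)=\frac{(\mu_1/\mu_2)^j}{\sum_{i=0}^n(\mu_1/\mu_2)^i},\qquad 0\le j\le n.$$ Then $$\limsup_{n\to\infty}\operatorname{E}\lambda(Z_n)<\mu_2\implies S(\lambda,\mu_1,\mu_2)\text{ is stable},$$ $$\liminf_{n\to\infty}\lambda(n)>\mu_2\implies S(\lambda,\mu_1,\mu_2)\text{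 is unstable}.$$ In particular, if $\lim_{n\to\infty}\lambda(n)$ exists in $[0,\infty]$, then $$\lim_{n\to\infty}\lambda(n)<\mu_2\implies S(\lambda,\mu_1,\mu_2)\text{ is stable},$$ $$\lim_{n\to\infty}\lambda(n)>\mu_2\implies S(\lambda,\mu_1,\mu_2)\text{ is unstable}.$$ -/

import Mathlib

open MeasureTheory ProbabilityTheory Filter Topology
open scoped NNReal ENNReal

/-! ### Minimal Markov jump processes on a countable state space -/

/-- Transition rates `q(x, y)`, `x ≠ y`, on a state space `S`, with finite total rate out of every
state. The diagonal carries no information and is set to `0`. -/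
structure JumpRates (S : Type*) where
  rate : S → S → ℝ≥0
  rate_self : ∀ x, rate x x = 0
  summable_rate : ∀ x, Summable (rate x)

namespace JumpRates

variable {S : Type*}

/-- The transition rate `q(x) = ∑_{y ≠ x} q(x, y)` out of state `x`. -/
noncomputable def exitRate (q : JumpRates S) (x : S) : ℝ≥0 := ∑' y, q.rate x y

theorem tsum_coe_rate (q : JumpRates S) (x : S) :
    ∑' y, (q.rate x y : ℝ≥0∞) = (q.exitRate x : ℝ≥0∞) :=
  (ENNReal.coe_tsum (q.summable_rate x)).symm

open Classical in
/-- The law of the next state after a visit to `x`: it is `y` with probability `q(x, y) / q(x)`.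
An absorbing state (`q(x) = 0`) is repeated. -/
noncomputable def jumpLaw (q : JumpRates S) (x : S) : PMF S :=
  if h : q.exitRate x = 0 then PMF.pure x
  else PMF.normalize (fun y => (q.rate x y : ℝ≥0∞))
    (by rw [tsum_coe_rate]; exact_mod_cast h)
    (by rw [tsum_coe_rate]; exact ENNReal.coe_ne_top)

section Law

variable [Countable S] [MeasurableSpace S] [DiscreteMeasurableSpace S]

/-- The transition kernel of the embedded jump chain. -/
noncomputable def jumpKernel (q : JumpRates S) : Kernel S S :=
  Kernel.ofFunOfCountable fun x => (q.jumpLaw x).toMeasure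

instance (q : JumpRates S) : IsMarkovKernel q.jumpKernel :=
  ⟨fun x => inferInstanceAs (IsProbabilityMeasure (q.jumpLaw x).toMeasure)⟩

/-- The kernel which produces the `(n+1)`-st state of the jump chain from its first states
`0, …, n`, using only state `n`. -/
noncomputable def historyKernel (q : JumpRates S) (n : ℕ) :
    Kernel (Π _ : Finset.Iic n, S) S :=
  q.jumpKernel.comap (fun h => h ⟨n, Finset.mem_Iic.2 le_rfl⟩) (measurable_pi_apply _)

instance (q : JumpRates S) (n : ℕ) : IsMarkovKernel (q.historyKernel n) := by
  unfold historyKernel; infer_instance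

/-- The law of the embedded jump chain `Y_0, Y_1, …` started at `Y_0 = x`. -/
noncomputable def chainLaw (q : JumpRates S) (x : S) : Measure (ℕ → S) :=
  Kernel.traj (X := fun _ => S) q.historyKernel 0 (fun _ => x)

/-- The sample space on which the process is built. A point `ω` consists of the path `ω.1` of the
embedded jump chain and of the sequence `ω.2` of holding times before scaling. -/
abbrev Sample (S : Type*) : Type _ := (ℕ → S) × (ℕ → ℝ)

/-- The probability `P_x`: the jump chain starts at `x`, and independently of it the unscaled
holding times are independent and exponentially distributed with parameter `1`. -/
noncomputable def law (q : JumpRates S) (x : S) : Measure (Sample S) :=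
  (q.chainLaw x).prod (Measure.infinitePi fun _ : ℕ => expMeasure 1)

end Law

/-- The time `J_n` of the `n`-th jump: the chain stays in `Y_k` for an exponential time with
parameter `q(Y_k)` (for an infinite time if `q(Y_k) = 0`). -/
noncomputable def jumpTime (q : JumpRates S) (ω : Sample S) (n : ℕ) : ℝ≥0∞ :=
  ∑ k ∈ Finset.range n, ENNReal.ofReal (ω.2 k) / (q.exitRate (ω.1 k) : ℝ≥0∞)

open Classical in
/-- The minimal process `X(t)`: it equals `Y_n` for `J_n ≤ t < J_{n+1}`, and it sits in the
additional state `κ = none` from the time of explosion `sup_n J_n` onwards. -/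
noncomputable def process (q : JumpRates S) (ω : Sample S) (t : ℝ≥0) : Option S :=
  if h : ∃ n, q.jumpTime ω n ≤ t ∧ t < q.jumpTime ω (n + 1) then some (ω.1 (Nat.find h))
  else none

/-- The first time at or after the first jump at which the process is in state `x`
(`∞` if there is none). For the process started at `x` this is the return time `T_x`. -/
noncomputable def returnTime (q : JumpRates S) (x : S) (ω : Sample S) : ℝ≥0∞ :=
  ⨅ (t : ℝ≥0) (_ : q.jumpTime ω 1 ≤ t ∧ q.process ω t = some x), (t : ℝ≥0∞)

section Ergodicity

variable [Countable S] [MeasurableSpace S] [DiscreteMeasurableSpace S]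

/-- Every state is visited with positive probability from every state. -/
def IsIrreducible (q : JumpRates S) : Prop :=
  ∀ x y : S, 0 < q.law x {ω | ∃ t : ℝ≥0, q.process ω t = some y}

/-- Every state is absorbing or has a finite expected return time. -/
def IsPositiveRecurrent (q : JumpRates S) : Prop :=
  ∀ x : S, q.exitRate x = 0 ∨ ∫⁻ ω, q.returnTime x ω ∂(q.law x) < ∞

/-- Ergodic: irreducible and positive recurrent. -/
def IsErgodic (q : JumpRates S) : Prop :=
  q.IsIrreducible ∧ q.IsPositiveRecurrent

end Ergodicity

end JumpRates

/-! ### The tandem network -/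

/-- The rates of the tandem network `S(λ, μ₁, μ₂)` on `ℤ₊²`: an arrival `x ↦ x + e₁` at rate
`λ(x₂)`, a transfer `x ↦ x - e₁ + e₂` at rate `μ₁`, a departure `x ↦ x - e₂` at rate `μ₂`. -/
noncomputable def tandemRate (lam : ℕ → ℝ≥0) (μ₁ μ₂ : ℝ≥0) (x y : ℕ × ℕ) : ℝ≥0 :=
  if y.1 = x.1 + 1 ∧ y.2 = x.2 then lam x.2
  else if x.1 = y.1 + 1 ∧ y.2 = x.2 + 1 then μ₁
  else if y.1 = x.1 ∧ x.2 = y.2 + 1 then μ₂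
  else 0

/-- The system `S(λ, μ₁, μ₂)`. -/
noncomputable def tandem (lam : ℕ → ℝ≥0) (μ₁ μ₂ : ℝ≥0) : JumpRates (ℕ × ℕ) where
  rate := tandemRate lam μ₁ μ₂
  rate_self x := by simp [tandemRate]
  summable_rate x := by
    refine summable_of_ne_finset_zero
      (s := {(x.1 + 1, x.2), (x.1 - 1, x.2 + 1), (x.1, x.2 - 1)}) fun y hy => ?_
    simp only [Finset.mem_insert, Finset.mem_singleton, not_or, Prod.ext_iff] at hy
    unfold tandemRate
    rw [if_neg (by omega), if_neg (by omega), if_neg (by omega)]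

/-- The system `S(λ, μ₁, μ₂)` is stable if its Markov process is ergodic. -/
def IsStableTandem (lam : ℕ → ℝ≥0) (μ₁ μ₂ : ℝ≥0) : Prop :=
  (tandem lam μ₁ μ₂).IsErgodic

/-! ### Truncated geometric distributions -/

/-- The distribution `geom_n(z)` on `{0, …, n}`, with `P(Z_n = j)` proportional to `z ^ j`. -/
noncomputable def truncGeom (n : ℕ) (z : ℝ≥0) : PMF ℕ :=
  PMF.normalize (fun j => if j ≤ n then (z : ℝ≥0∞) ^ j else 0)
    (by
      refine (ENNReal.summable.tsum_ne_zero_iff).2 ⟨0, ?_⟩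
      simp)
    (by
      rw [tsum_eq_sum (s := Finset.range (n + 1)) fun j hj => if_neg (by
        simpa [Nat.lt_succ_iff] using hj)]
      refine (ENNReal.sum_lt_top.2 fun j _ => ?_).ne
      split_ifs
      · exact ENNReal.pow_lt_top ENNReal.coe_lt_top
      · exact ENNReal.zero_lt_top)

/-- The expectation `E λ(Z_n)` for `Z_n ∼ geom_n(z)`. -/
noncomputable def truncGeomMean (lam : ℕ → ℝ≥0) (n : ℕ) (z : ℝ≥0) : ℝ≥0∞ :=
  ∫⁻ j, (lam j : ℝ≥0∞) ∂(truncGeom n z).toMeasure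

/-!
The proof works with the embedded jump chain of the network and with two functions of the form
`x₁ + g(x₂)`.

**From the jump chain to the process.** Let `a_n(y)` be the probability that the chain started at
`y` avoids a given state `x` at the times `1, …, n` (`avoidProb`, identified with the trajectory
measure in `chainLaw_avoidSet`). The exit rates of the network are bounded below, so the holding
times have bounded means, and since they are independent of the chain, the expected return time to
`x` is finite if `∑ a_n(x) < ∞` (`lintegral_returnTime_lt_top`). It is infinite if `a_n(x)` stays
away from `0` (`lintegral_returnTime_eq_top`). The first condition follows from a function `V ≥ 0`
which decreases on average by `ε` at each jump from outside a finite set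
(`tsum_avoidProb_lt_top`); the second from a bounded superharmonic function off a set which is
smaller at some state than on that set (`one_le_avoidProb_add`).

**Stability.** If `h(n) = g(n + 1) - g(n)`, the drift of `x₁ + g(x₂)` at `(x₁, n)` with `x₁ > 0` is
`λ(n) - μ₁ + μ₁ h(n) - μ₂ h(n - 1)`. Setting it equal to `-ε (λ(n) + μ₁ + μ₂)` determines `h`; with
`z = μ₁ / μ₂`,
`μ₁ z ^ n h(n) = ∑_{j ≤ n} z ^ j (μ₁ - ε (μ₁ + μ₂) - (1 + ε) λ(j))`,
which is where the truncated geometric means of `λ` come from. If these are at most `d < μ₂` from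
some level on, then `h(n) ≥ 1` for large `n` (`eventually_one_le_lyapunovSlope`). At `(0, n)` the
transfers are missing, which changes the drift by `-μ₁ (h(n) - 1) ≤ 0`; so the drift is at most
`-ε (λ(n) + μ₁ + μ₂)` except at the finitely many states `(0, n)` with `n` small. As this bound is
`-ε` times a bound of the exit rate, the jump chain has drift at most `-ε`, even if `λ` is unbounded
and the process might explode a priori.

**Instability.** If `λ ≥ μ₂ + 2 ε` from the level `n₀` on, one can choose a bounded slope
`1 + κ ≥ 1` of `g` with `κ = 0` at high levels such that `x₁ + g(x₂)` has drift at least `ε` off a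
finite set, even if the arrival rate is replaced by `μ₂ + 2 ε` at the levels from `n₀` on and by `0`
below (`le_add_mul_slopeExcess_sub`). Then `exp (-s (x₁ + g(x₂)))` is superharmonic off this set for
small `s > 0`, and it tends to `0` along the states `(m, 0)`. Hence the chain is transient.
-/

/-! ### Avoidance probabilities of the jump chain -/

namespace JumpRates

variable {S : Type*} [Countable S] [MeasurableSpace S] [DiscreteMeasurableSpace S]

theorem jumpKernel_apply (q : JumpRates S) (y : S) :
    q.jumpKernel y = (q.jumpLaw y).toMeasure := rfl

theorem lintegral_jumpKernel (q : JumpRates S) {y : S} (hy : q.exitRate y ≠ 0) (f : S → ℝ≥0∞) :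
    ∫⁻ z, f z ∂(q.jumpKernel y) = (∑' z, (q.rate y z : ℝ≥0∞) * f z) / q.exitRate y := by
  rw [jumpKernel_apply, lintegral_countable', div_eq_mul_inv, ← ENNReal.tsum_mul_right]
  refine tsum_congr fun z => ?_
  rw [PMF.toMeasure_apply_singleton _ _ (measurableSet_singleton z), jumpLaw, dif_neg hy,
    PMF.normalize_apply, tsum_coe_rate]
  ring

theorem jumpKernel_singleton_pos (q : JumpRates S) {y z : S} (h : 0 < q.rate y z) :
    0 < q.jumpKernel y {z} := by
  have hy : q.exitRate y ≠ 0 := by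
    have := (q.summable_rate y).le_tsum z fun _ _ => zero_le
    exact (h.trans_le this).ne'
  rw [jumpKernel_apply, PMF.toMeasure_apply_singleton _ _ (measurableSet_singleton z),
    pos_iff_ne_zero, ← PMF.mem_support_iff, jumpLaw, dif_neg hy, PMF.mem_support_normalize_iff]
  exact_mod_cast h.ne'

/-- The probability that the jump chain started at `y` avoids `x` at each of the times
`1, …, n`, computed by conditioning on the first jump. -/
noncomputable def avoidProb (q : JumpRates S) (x : S) : ℕ → S → ℝ≥0∞
  | 0, _ => 1
  | n + 1, y => ∫⁻ z in {x}ᶜ, avoidProb q x n z ∂(q.jumpKernel y)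

/-- The expected number of visits to `A` at the times `0, …, n - 1` which take place before the
first return to `x`, for the jump chain started at `y`. -/
noncomputable def expectedVisits (q : JumpRates S) (x : S) (A : Set S) : ℕ → S → ℝ≥0∞
  | 0, _ => 0
  | n + 1, y => A.indicator 1 y + ∫⁻ z in {x}ᶜ, expectedVisits q x A n z ∂(q.jumpKernel y)

/-- One state can be reached from another in at least one jump of positive rate. -/
def Reaches (q : JumpRates S) : S → S → Prop :=
  Relation.TransGen fun y z => 0 < q.rate y z

theorem setLIntegral_jumpKernel_le (q : JumpRates S) (x y : S) {f : S → ℝ≥0∞} {c : ℝ≥0∞}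
    (hf : ∀ z, f z ≤ c) : ∫⁻ z in {x}ᶜ, f z ∂(q.jumpKernel y) ≤ c :=
  calc _ ≤ ∫⁻ z, f z ∂(q.jumpKernel y) := setLIntegral_le_lintegral _ _
    _ ≤ ∫⁻ _, c ∂(q.jumpKernel y) := lintegral_mono hf
    _ = c := by simp

theorem avoidProb_le_one (q : JumpRates S) (x : S) (n : ℕ) (y : S) : q.avoidProb x n y ≤ 1 := by
  induction n generalizing y with
  | zero => exact le_rfl
  | succ n ih => exact q.setLIntegral_jumpKernel_le x y ih

theorem avoidProb_antitone (q : JumpRates S) (x y : S) : Antitone fun n => q.avoidProb x n y := by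
  refine antitone_nat_of_succ_le fun n => ?_
  induction n generalizing y with
  | zero => exact q.avoidProb_le_one x 1 y
  | succ n ih => exact lintegral_mono fun z => ih z

theorem avoidProb_succ_lt_one (q : JumpRates S) {x y z : S} {n : ℕ} (hyz : 0 < q.rate y z)
    (hz : z = x ∨ q.avoidProb x n z < 1) : q.avoidProb x (n + 1) y < 1 := by
  have hle : ∀ w, ({x}ᶜ : Set S).indicator (q.avoidProb x n) w ≤ 1 := fun w =>
    (Set.indicator_le_self _ _ w).trans (q.avoidProb_le_one x n w)
  have hlt : ({x}ᶜ : Set S).indicator (q.avoidProb x n) z < 1 := by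
    rcases hz with rfl | hz
    · simp
    · exact (Set.indicator_le_self _ _ z).trans_lt hz
  have := lintegral_strict_mono_of_ae_le_of_ae_lt_on (μ := q.jumpKernel y)
    (f := ({x}ᶜ : Set S).indicator (q.avoidProb x n)) (g := fun _ => 1)
    (aemeasurable_const)
    (((lintegral_mono hle).trans_lt (by simp)).ne) (Eventually.of_forall hle) (s := {z})
    (q.jumpKernel_singleton_pos hyz).ne' (Eventually.of_forall fun w hw => by
      rw [Set.mem_singleton_iff] at hw; subst hw; exact hlt)
  rwa [lintegral_indicator (measurableSet_singleton x).compl, lintegral_one,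
    measure_univ] at this

theorem Reaches.exists_avoidProb_lt_one {q : JumpRates S} {x y : S} (h : q.Reaches y x) :
    ∃ n, q.avoidProb x n y < 1 := by
  induction h using Relation.TransGen.head_induction_on with
  | single h => exact ⟨1, q.avoidProb_succ_lt_one h (Or.inl rfl)⟩
  | head h _ ih =>
    obtain ⟨n, hn⟩ := ih
    exact ⟨n + 1, q.avoidProb_succ_lt_one h (Or.inr hn)⟩

theorem exists_avoidProb_le_of_finset (q : JumpRates S) {x : S} (F : Finset S)
    (hF : ∀ y ∈ F, q.Reaches y x) :
    ∃ n, 0 < n ∧ ∃ ρ < 1, ∀ y ∈ F, q.avoidProb x n y ≤ ρ := by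
  classical
  induction F using Finset.induction_on with
  | empty => exact ⟨1, one_pos, 0, one_pos, by simp⟩
  | insert a F _ ih =>
    obtain ⟨n, hn, ρ, hρ, h⟩ := ih fun y hy => hF y (Finset.mem_insert_of_mem hy)
    obtain ⟨m, hm⟩ := (hF a (Finset.mem_insert_self _ _)).exists_avoidProb_lt_one
    refine ⟨max n m, by omega, max ρ (q.avoidProb x m a), max_lt hρ hm, fun y hy => ?_⟩
    rcases Finset.mem_insert.1 hy with rfl | hy
    · exact (q.avoidProb_antitone x y (le_max_right n m)).trans (le_max_right _ _)
    · exact ((q.avoidProb_antitone x y (le_max_left n m)).trans (h y hy)).trans (le_max_left _ _)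

theorem sum_avoidProb (q : JumpRates S) (x : S) (n : ℕ) (y : S) :
    ∑ k ∈ Finset.range n, q.avoidProb x k y = q.expectedVisits x Set.univ n y := by
  induction n generalizing y with
  | zero => simp [expectedVisits]
  | succ n ih =>
    rw [Finset.sum_range_succ', add_comm]
    simp only [expectedVisits, avoidProb, ← ih, Set.indicator_univ, Pi.one_apply]
    rw [lintegral_finsetSum _ fun _ _ => Measurable.of_discrete]

theorem expectedVisits_le_natCast (q : JumpRates S) (x : S) (A : Set S) (n : ℕ) (y : S) :
    q.expectedVisits x A n y ≤ n := by
  induction n generalizing y with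
  | zero => simp [expectedVisits]
  | succ n ih =>
    rw [expectedVisits, Nat.cast_succ, add_comm (n : ℝ≥0∞)]
    exact add_le_add (Set.indicator_le_self' (by simp) y)
      (q.setLIntegral_jumpKernel_le x y ih)

theorem expectedVisits_add_le (q : JumpRates S) (x : S) (A : Set S) {n : ℕ} {b : ℝ≥0∞}
    (hb : ∀ y, q.expectedVisits x A n y ≤ b) (k : ℕ) (y : S) :
    q.expectedVisits x A (n + k) y ≤ k + b * q.avoidProb x k y := by
  induction k generalizing y with
  | zero => simpa [avoidProb] using hb y
  | succ k ih =>
    rw [← add_assoc, expectedVisits, avoidProb, Nat.cast_succ, add_comm (k : ℝ≥0∞), add_assoc]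
    refine add_le_add (Set.indicator_le_self' (by simp) y) ?_
    calc _ ≤ ∫⁻ z in {x}ᶜ, (k + b * q.avoidProb x k z) ∂(q.jumpKernel y) := lintegral_mono ih
      _ = ∫⁻ _ in {x}ᶜ, (k : ℝ≥0∞) ∂(q.jumpKernel y)
          + b * ∫⁻ z in {x}ᶜ, q.avoidProb x k z ∂(q.jumpKernel y) := by
        rw [lintegral_add_left measurable_const, lintegral_const_mul _ Measurable.of_discrete]
      _ ≤ _ := by gcongr; exact q.setLIntegral_jumpKernel_le x y fun _ => le_rfl

/-- The expected number of visits to a finite set before the return to `x` is bounded: from each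
point of the set, `x` is reached within `k` jumps with a probability bounded from below, so that
the visits are dominated by `k` times a geometric number of trials. -/
theorem exists_expectedVisits_le (q : JumpRates S) {x : S} (F : Finset S)
    (hF : ∀ y ∈ F, q.Reaches y x) :
    ∃ b : ℝ≥0∞, b ≠ ∞ ∧ ∀ n y, q.expectedVisits x F n y ≤ b := by
  obtain ⟨k, hk, ρ, hρ, h⟩ := q.exists_avoidProb_le_of_finset F hF
  have hρ' : 1 - ρ ≠ 0 := (tsub_pos_of_lt hρ).ne'
  have hρ'' : 1 - ρ ≠ ∞ := ENNReal.sub_ne_top ENNReal.one_ne_top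
  -- `b = k / (1 - ρ)` is the fixed point of `b ↦ k + b ρ`
  set b : ℝ≥0∞ := k / (1 - ρ) with hb
  have hfix : (k : ℝ≥0∞) + b * ρ = b := by
    have h1 : b * (1 - ρ) = k := ENNReal.div_mul_cancel hρ' hρ''
    rw [← h1, ← mul_add, tsub_add_cancel_of_le hρ.le, mul_one]
  have hkb : (k : ℝ≥0∞) ≤ b := hfix ▸ le_self_add
  refine ⟨b, ENNReal.div_ne_top (ENNReal.natCast_ne_top k) hρ', fun n => ?_⟩
  induction n using Nat.strong_induction_on with
  | _ n ih =>
    intro y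
    by_cases hy : y ∈ F
    · by_cases hn : n < k
      · exact (q.expectedVisits_le_natCast x F n y).trans
          ((Nat.cast_le.2 hn.le).trans hkb)
      · obtain ⟨m, rfl⟩ := Nat.exists_eq_add_of_le' (not_lt.1 hn)
        calc _ ≤ k + b * q.avoidProb x k y :=
              q.expectedVisits_add_le x F (ih m (by omega)) k y
          _ ≤ k + b * ρ := by gcongr; exact h y hy
          _ = b := hfix
    · cases n with
      | zero => simp [expectedVisits]
      | succ n =>
        rw [expectedVisits, Set.indicator_of_notMem (by simpa using hy), zero_add]
        exact q.setLIntegral_jumpKernel_le x y (ih n n.lt_succ_self)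

/-- Foster's criterion for the jump chain: if `V` decreases on average by `ε` at each jump from
outside a finite set, then the return to `x` takes a finite expected number of jumps. -/
theorem tsum_avoidProb_lt_top (q : JumpRates S) {x : S} (F : Finset S)
    (hF : ∀ y ∈ F, q.Reaches y x) (V : S → ℝ≥0∞) (hV : V x ≠ ∞) {ε M : ℝ≥0∞}
    (hε : ε ≠ 0) (hε' : ε ≠ ∞) (hM : M ≠ ∞)
    (hdrift : ∀ y, ∫⁻ z, V z ∂(q.jumpKernel y) + ε ≤ V y + M * (F : Set S).indicator 1 y) :
    ∑' n, q.avoidProb x n x < ∞ := by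
  obtain ⟨b, hb, hvis⟩ := q.exists_expectedVisits_le F hF
  have key : ∀ n y, q.expectedVisits x Set.univ n y
      ≤ ε⁻¹ * V y + ε⁻¹ * M * q.expectedVisits x F n y := by
    intro n
    induction n with
    | zero => simp [expectedVisits]
    | succ n ih =>
      intro y
      rw [expectedVisits, Set.indicator_univ, Pi.one_apply]
      calc 1 + ∫⁻ z in {x}ᶜ, q.expectedVisits x Set.univ n z ∂(q.jumpKernel y)
          ≤ 1 + ∫⁻ z in {x}ᶜ, (ε⁻¹ * V z + ε⁻¹ * M * q.expectedVisits x F n z)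
              ∂(q.jumpKernel y) := by gcongr; exact ih _
        _ = 1 + (ε⁻¹ * ∫⁻ z in {x}ᶜ, V z ∂(q.jumpKernel y)
              + ε⁻¹ * M * ∫⁻ z in {x}ᶜ, q.expectedVisits x F n z ∂(q.jumpKernel y)) := by
            rw [lintegral_add_left Measurable.of_discrete,
              lintegral_const_mul _ Measurable.of_discrete,
              lintegral_const_mul _ Measurable.of_discrete]
        _ ≤ 1 + (ε⁻¹ * ∫⁻ z, V z ∂(q.jumpKernel y)
              + ε⁻¹ * M * ∫⁻ z in {x}ᶜ, q.expectedVisits x F n z ∂(q.jumpKernel y)) := by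
            have := setLIntegral_le_lintegral (μ := q.jumpKernel y) {x}ᶜ V
            exact add_le_add le_rfl (add_le_add (mul_le_mul_right this _) le_rfl)
        _ = ε⁻¹ * (∫⁻ z, V z ∂(q.jumpKernel y) + ε)
              + ε⁻¹ * M * ∫⁻ z in {x}ᶜ, q.expectedVisits x F n z ∂(q.jumpKernel y) := by
            rw [mul_add, ENNReal.inv_mul_cancel hε hε']; ring
        _ ≤ ε⁻¹ * (V y + M * (F : Set S).indicator 1 y)
              + ε⁻¹ * M * ∫⁻ z in {x}ᶜ, q.expectedVisits x F n z ∂(q.jumpKernel y) := by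
            exact add_le_add (mul_le_mul_right (hdrift y) _) le_rfl
        _ = _ := by rw [expectedVisits]; ring
  have hfin : ε⁻¹ * V x + ε⁻¹ * M * b ≠ ∞ :=
    ENNReal.add_ne_top.2 ⟨ENNReal.mul_ne_top (ENNReal.inv_ne_top.2 hε) hV,
      ENNReal.mul_ne_top (ENNReal.mul_ne_top (ENNReal.inv_ne_top.2 hε) hM) hb⟩
  refine lt_of_le_of_lt ?_ hfin.lt_top
  rw [ENNReal.tsum_eq_iSup_nat]
  refine iSup_le fun n => ?_
  rw [sum_avoidProb]
  refine (key n x).trans ?_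
  gcongr
  exact hvis n x

/-- A function which is superharmonic off a set `F` containing `o`, and at least `1` on `F`,
dominates the probability that the chain visits `o`. -/
theorem one_le_avoidProb_add (q : JumpRates S) {o : S} {F : Set S} (ho : o ∈ F) {φ : S → ℝ≥0∞}
    (hφF : ∀ y ∈ F, 1 ≤ φ y) (hφ : ∀ y ∉ F, ∫⁻ z, φ z ∂(q.jumpKernel y) ≤ φ y) (n : ℕ) (y : S) :
    1 ≤ q.avoidProb o n y + φ y := by
  induction n generalizing y with
  | zero => exact le_self_add
  | succ n ih =>
    by_cases hy : y ∈ F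
    · exact (hφF y hy).trans le_add_self
    · calc (1 : ℝ≥0∞) = ∫⁻ _, 1 ∂(q.jumpKernel y) := by simp
        _ = ∫⁻ _ in {o}, 1 ∂(q.jumpKernel y) + ∫⁻ _ in {o}ᶜ, 1 ∂(q.jumpKernel y) :=
          (lintegral_add_compl _ (measurableSet_singleton o)).symm
        _ ≤ ∫⁻ z in {o}, φ z ∂(q.jumpKernel y)
            + ∫⁻ z in {o}ᶜ, (q.avoidProb o n z + φ z) ∂(q.jumpKernel y) := by
          refine add_le_add (setLIntegral_mono Measurable.of_discrete fun z hz => ?_)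
            (lintegral_mono ih)
          rw [Set.mem_singleton_iff.1 hz]
          exact hφF o ho
        _ = q.avoidProb o (n + 1) y + ∫⁻ z, φ z ∂(q.jumpKernel y) := by
          rw [lintegral_add_left Measurable.of_discrete, avoidProb,
            ← lintegral_add_compl (μ := q.jumpKernel y) φ (measurableSet_singleton o)]
          ring
        _ ≤ _ := by gcongr; exact hφ y hy

/-- If `o` is avoided forever from `z` with positive probability, then also from each state which
has a jump to `z`. -/
theorem exists_le_avoidProb_of_rate_pos (q : JumpRates S) {o y z : S} (hyz : 0 < q.rate y z)
    (hz : z ≠ o) (h : ∃ c, 0 < c ∧ ∀ n, c ≤ q.avoidProb o n z) :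
    ∃ c, 0 < c ∧ ∀ n, c ≤ q.avoidProb o n y := by
  obtain ⟨c, hc, h⟩ := h
  have key : ∀ n, c * q.jumpKernel y {z} ≤ q.avoidProb o (n + 1) y := fun n =>
    calc c * q.jumpKernel y {z} = ∫⁻ _ in {z}, c ∂(q.jumpKernel y) := by simp
      _ ≤ ∫⁻ w in {z}, q.avoidProb o n w ∂(q.jumpKernel y) := by
        refine setLIntegral_mono Measurable.of_discrete fun w hw => ?_
        rw [Set.mem_singleton_iff.1 hw]
        exact h n
      _ ≤ _ := lintegral_mono_set (by simpa using hz.symm)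
  refine ⟨_, ENNReal.mul_pos hc.ne' (q.jumpKernel_singleton_pos hyz).ne', fun n => ?_⟩
  cases n with
  | zero => exact (key 0).trans (q.avoidProb_le_one o 1 y)
  | succ n => exact key n

end JumpRates

/-! ### The Markov property of the trajectories -/

namespace JumpRates

variable {S : Type*} [Countable S] [MeasurableSpace S] [DiscreteMeasurableSpace S]

instance (q : JumpRates S) (x : S) : IsProbabilityMeasure (q.chainLaw x) := by
  unfold chainLaw; infer_instance

/-- The Markov property of the jump chain at time `n`. -/
theorem lintegral_chainLaw_mul (q : JumpRates S) (y : S) (n : ℕ)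
    {g : (Π _ : Finset.Iic n, S) → ℝ≥0∞} (hg : Measurable g) (f : S → ℝ≥0∞) :
    ∫⁻ Y, g (Preorder.frestrictLe n Y) * f (Y (n + 1)) ∂(q.chainLaw y)
      = ∫⁻ Y, g (Preorder.frestrictLe n Y) * ∫⁻ z, f z ∂(q.jumpKernel (Y n))
          ∂(q.chainLaw y) := by
  have hf : Measurable f := Measurable.of_discrete
  have hG : Measurable fun p : (Π _ : Finset.Iic n, S) × S => g p.1 * f p.2 :=
    (hg.comp measurable_fst).mul (hf.comp measurable_snd)
  have hp : Measurable fun Y : ℕ → S => (Preorder.frestrictLe (π := fun _ => S) n Y, Y (n + 1)) :=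
    (Preorder.measurable_frestrictLe n).prodMk (measurable_pi_apply (n + 1))
  have h1 : ∫⁻ Y, g (Preorder.frestrictLe n Y) * f (Y (n + 1)) ∂(q.chainLaw y)
      = ∫⁻ p, g p.1 * f p.2 ∂((q.chainLaw y).map
          (fun Y => (Preorder.frestrictLe n Y, Y (n + 1)))) :=
    (lintegral_map hG hp).symm
  have h2 : (q.chainLaw y).map (fun Y => (Preorder.frestrictLe (π := fun _ => S) n Y, Y (n + 1)))
      = (Kernel.partialTraj (X := fun _ => S) q.historyKernel 0 n fun _ => y)
          ⊗ₘ q.historyKernel n :=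
    (Kernel.partialTraj_compProd_eq_map_traj (X := fun _ => S) (κ := q.historyKernel)
      (Nat.zero_le n) (x₀ := fun _ => y)).symm
  rw [h1, h2, Measure.lintegral_compProd hG,
    ← Kernel.traj_map_frestrictLe_apply, chainLaw, lintegral_map hG.lintegral_kernel_prod_right'
    (Preorder.measurable_frestrictLe n)]
  refine lintegral_congr fun Y => ?_
  exact lintegral_const_mul (μ := q.jumpKernel (Y n)) (g (Preorder.frestrictLe n Y)) hf

theorem chainLaw_ae_zero (q : JumpRates S) (y : S) : ∀ᵐ Y ∂(q.chainLaw y), Y 0 = y := by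
  have h : (q.chainLaw y).map (Preorder.frestrictLe (π := fun _ => S) 0)
      = Measure.dirac fun _ => y := by
    rw [chainLaw, Kernel.traj_map_frestrictLe_apply, Kernel.partialTraj_self, Kernel.id_apply]
  have he : Measurable fun h : (Π _ : Finset.Iic 0, S) => h ⟨0, by simp⟩ :=
    measurable_pi_apply _
  have h2 : ∀ᵐ h ∂((q.chainLaw y).map (Preorder.frestrictLe (π := fun _ => S) 0)),
      h ⟨0, by simp⟩ = y := by
    rw [h]
    exact (ae_dirac_iff (he (measurableSet_singleton y))).2 rfl
  exact ae_of_ae_map (Preorder.measurable_frestrictLe 0).aemeasurable h2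

/-- The paths which avoid `x` at the times `1, …, n`. -/
def avoidSet (x : S) (n : ℕ) : Set (ℕ → S) := {Y | ∀ i, 1 ≤ i → i ≤ n → Y i ≠ x}

theorem measurableSet_avoidSet (x : S) (n : ℕ) : MeasurableSet (avoidSet x n) := by
  simp only [avoidSet, Set.ofPred_forall]
  refine MeasurableSet.iInter fun i => MeasurableSet.iInter fun _ => MeasurableSet.iInter fun _ => ?_
  have hi : Measurable fun Y : ℕ → S => Y i := measurable_pi_apply i
  exact hi (measurableSet_singleton x).compl

theorem setLIntegral_avoidSet_succ (q : JumpRates S) (x y : S) (n : ℕ) (f : S → ℝ≥0∞) :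
    ∫⁻ Y in avoidSet x (n + 1), f (Y (n + 1)) ∂(q.chainLaw y)
      = ∫⁻ Y in avoidSet x n, ∫⁻ z in {x}ᶜ, f z ∂(q.jumpKernel (Y n)) ∂(q.chainLaw y) := by
  let A : Set (Π _ : Finset.Iic n, S) := {h | ∀ i : Finset.Iic n, 1 ≤ (i : ℕ) → h i ≠ x}
  have hA : MeasurableSet A := by
    simp only [A, Set.ofPred_forall]
    refine MeasurableSet.iInter fun i => MeasurableSet.iInter fun _ => ?_
    have hi : Measurable fun h : (Π _ : Finset.Iic n, S) => h i := measurable_pi_apply i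
    exact hi (measurableSet_singleton x).compl
  have hmem : ∀ Y : ℕ → S, Preorder.frestrictLe n Y ∈ A ↔ Y ∈ avoidSet x n := fun Y =>
    ⟨fun h i h1 h2 => h ⟨i, Finset.mem_Iic.2 h2⟩ h1, fun h i h1 => h i h1 (Finset.mem_Iic.1 i.2)⟩
  have key := q.lintegral_chainLaw_mul y n (g := A.indicator 1)
    (measurable_one.indicator hA) (({x}ᶜ : Set S).indicator f)
  rw [← lintegral_indicator (measurableSet_avoidSet x (n + 1)),
    ← lintegral_indicator (measurableSet_avoidSet x n)]
  refine Eq.trans (lintegral_congr fun Y => ?_) (key.trans (lintegral_congr fun Y => ?_))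
  · by_cases h : Y ∈ avoidSet x n
    · by_cases hx : Y (n + 1) = x
      · have : Y ∉ avoidSet x (n + 1) := fun h' => h' (n + 1) (by omega) le_rfl hx
        simp [this, hx]
      · have : Y ∈ avoidSet x (n + 1) := fun i h1 h2 => by
          rcases Nat.lt_or_ge i (n + 1) with h3 | h3
          · exact h i h1 (by omega)
          · rwa [le_antisymm h2 h3]
        simp [this, hx, (hmem Y).2 h]
    · have : Y ∉ avoidSet x (n + 1) := fun h' => h fun i h1 h2 => h' i h1 (by omega)
      have h' : Preorder.frestrictLe n Y ∉ A := fun h' => h ((hmem Y).1 h')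
      simp [this, h']
  · rw [lintegral_indicator (measurableSet_singleton x).compl]
    by_cases h : Y ∈ avoidSet x n
    · simp [h, (hmem Y).2 h]
    · have h' : Preorder.frestrictLe n Y ∉ A := fun h' => h ((hmem Y).1 h')
      simp [h, h']

theorem chainLaw_avoidSet (q : JumpRates S) (x y : S) (n : ℕ) :
    q.chainLaw y (avoidSet x n) = q.avoidProb x n y := by
  have key : ∀ k m, ∫⁻ Y in avoidSet x k, q.avoidProb x m (Y k) ∂(q.chainLaw y)
      = q.avoidProb x (k + m) y := by
    intro k
    induction k with
    | zero =>
      intro m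
      have h : avoidSet x 0 = Set.univ := Set.eq_univ_of_forall fun Y i h1 h2 => by omega
      rw [h, Measure.restrict_univ, lintegral_congr_ae (g := fun _ => q.avoidProb x m y)]
      · simp
      · filter_upwards [q.chainLaw_ae_zero y] with Y hY
        rw [hY]
    | succ k ih =>
      intro m
      rw [q.setLIntegral_avoidSet_succ x y k, show k + 1 + m = k + (m + 1) by omega, ← ih]
      rfl
  have := key n 0
  simpa [avoidProb] using this

end JumpRates

/-! ### Return times of the process -/

theorem lintegral_ofReal_expMeasure_one_ne_top :
    ∫⁻ s, ENNReal.ofReal s ∂(expMeasure 1) ≠ ∞ := by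
  have hint : IntegrableOn (fun x : ℝ => Real.exp (-x) * x ^ ((2 : ℝ) - 1)) (Set.Ioi 0) :=
    Real.GammaIntegral_convergent two_pos
  have hm : Measurable (gammaPDF 1 1) := (measurable_gammaPDFReal 1 1).ennreal_ofReal
  rw [expMeasure, gammaMeasure,
    lintegral_withDensity_eq_lintegral_mul _ hm ENNReal.measurable_ofReal]
  have hle : ∀ x : ℝ, (gammaPDF 1 1 * fun s => ENNReal.ofReal s) x ≤
      (Set.Ioi 0).indicator
        (fun x : ℝ => ENNReal.ofReal (Real.exp (-x) * x ^ ((2 : ℝ) - 1))) x := by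
    intro x
    rcases le_or_gt x 0 with hx | hx
    · simp [ENNReal.ofReal_of_nonpos hx]
    · rw [Set.indicator_of_mem (Set.mem_Ioi.2 hx), Pi.mul_apply, gammaPDF_of_nonneg hx.le,
        ← ENNReal.ofReal_mul (by positivity)]
      refine ENNReal.ofReal_le_ofReal (le_of_eq ?_)
      norm_num
  refine ((lintegral_mono hle).trans_lt ?_).ne
  rw [lintegral_indicator measurableSet_Ioi]
  exact hint.lintegral_lt_top

theorem expMeasure_one_ae_pos : ∀ᵐ s ∂(expMeasure 1), 0 < s := by
  have := isProbabilityMeasure_expMeasure one_pos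
  have h := cdf_expMeasure_eq one_pos 0
  rw [cdf_eq_real] at h
  have h0 : expMeasure 1 (Set.Iic 0) = 0 := by
    rw [← measureReal_eq_zero_iff, h]; simp
  filter_upwards [measure_eq_zero_iff_ae_notMem.1 h0] with s hs
  simpa using hs

namespace JumpRates

variable {S : Type*}

theorem jumpTime_mono (q : JumpRates S) (ω : Sample S) : Monotone (q.jumpTime ω) :=
  fun _ _ h => Finset.sum_le_sum_of_subset (Finset.range_mono h)

theorem process_eq_some (q : JumpRates S) {ω : Sample S} {n : ℕ} {t : ℝ≥0}
    (h : q.jumpTime ω n ≤ t) (h' : t < q.jumpTime ω (n + 1)) :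
    q.process ω t = some (ω.1 n) := by
  classical
  have hex : ∃ n, q.jumpTime ω n ≤ t ∧ t < q.jumpTime ω (n + 1) := ⟨n, h, h'⟩
  rw [process, dif_pos hex]
  have hle := Nat.find_min' hex ⟨h, h'⟩
  have hge : n ≤ Nat.find hex := by
    by_contra! hlt
    exact absurd ((q.jumpTime_mono ω (Nat.succ_le_of_lt hlt)).trans h)
      (not_le.2 (Nat.find_spec hex).2)
  rw [le_antisymm hle hge]

theorem exists_of_process_eq_some (q : JumpRates S) {ω : Sample S} {t : ℝ≥0} {y : S}
    (h : q.process ω t = some y) :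
    ∃ n, q.jumpTime ω n ≤ t ∧ t < q.jumpTime ω (n + 1) ∧ ω.1 n = y := by
  classical
  rw [process] at h
  split_ifs at h with hex
  exact ⟨_, (Nat.find_spec hex).1, (Nat.find_spec hex).2, Option.some_injective _ h⟩

theorem jumpTime_ne_top (q : JumpRates S) (hq : ∀ y, q.exitRate y ≠ 0) (ω : Sample S) (n : ℕ) :
    q.jumpTime ω n ≠ ∞ :=
  ENNReal.sum_ne_top.2 fun _ _ =>
    ENNReal.div_ne_top ENNReal.ofReal_ne_top (ENNReal.coe_ne_zero.2 (hq _))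

theorem process_jumpTime (q : JumpRates S) (hq : ∀ y, q.exitRate y ≠ 0) {ω : Sample S}
    (hω : ∀ k, 0 < ω.2 k) (n : ℕ) :
    q.process ω (q.jumpTime ω n).toNNReal = some (ω.1 n) := by
  have hn := ENNReal.coe_toNNReal (q.jumpTime_ne_top hq ω n)
  refine q.process_eq_some hn.ge ?_
  rw [hn, jumpTime, jumpTime, Finset.sum_range_succ]
  exact ENNReal.lt_add_right (q.jumpTime_ne_top hq ω n)
    (ENNReal.div_pos (ENNReal.ofReal_pos.2 (hω n)).ne' ENNReal.coe_ne_top).ne'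

/-- Up to the return to `x`, the time spent in the states visited adds up to the return time. -/
theorem returnTime_le_tsum (q : JumpRates S) (hq : ∀ y, q.exitRate y ≠ 0) {x : S} {ω : Sample S}
    (hω : ∀ k, 0 < ω.2 k) (hx : ∃ n, ω.1 ∉ avoidSet x n) :
    q.returnTime x ω ≤
      ∑' k, (avoidSet x k).indicator 1 ω.1 / (q.exitRate (ω.1 k) : ℝ≥0∞)
        * ENNReal.ofReal (ω.2 k) := by
  classical
  have hx' : ∃ n, 1 ≤ n ∧ ω.1 n = x := by
    obtain ⟨n, hn⟩ := hx
    simp only [avoidSet, Set.mem_ofPred_eq, not_forall, not_not] at hn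
    obtain ⟨i, h1, _, h3⟩ := hn
    exact ⟨i, h1, h3⟩
  obtain ⟨hn1, hnx⟩ := Nat.find_spec hx'
  set n := Nat.find hx' with hn
  have hfin := q.jumpTime_ne_top hq ω n
  calc q.returnTime x ω ≤ ((q.jumpTime ω n).toNNReal : ℝ≥0∞) := by
        refine iInf₂_le _ ⟨?_, ?_⟩
        · rw [ENNReal.coe_toNNReal hfin]
          exact q.jumpTime_mono ω hn1
        · rw [q.process_jumpTime hq hω, hnx]
    _ = q.jumpTime ω n := ENNReal.coe_toNNReal hfin
    _ = ∑ k ∈ Finset.range n, (avoidSet x k).indicator 1 ω.1 / (q.exitRate (ω.1 k) : ℝ≥0∞)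
        * ENNReal.ofReal (ω.2 k) := by
        refine Finset.sum_congr rfl fun k hk => ?_
        have hmem : ω.1 ∈ avoidSet x k := fun i h1 h2 h3 =>
          Nat.find_min hx' (lt_of_le_of_lt h2 (Finset.mem_range.1 hk)) ⟨h1, h3⟩
        rw [Set.indicator_of_mem hmem, Pi.one_apply, div_eq_mul_inv, div_eq_mul_inv, one_mul,
          mul_comm]
    _ ≤ _ := ENNReal.sum_le_tsum _

section Law

variable [Countable S] [MeasurableSpace S] [DiscreteMeasurableSpace S]

instance : IsProbabilityMeasure (expMeasure 1) := isProbabilityMeasure_expMeasure one_pos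

instance (q : JumpRates S) (x : S) : IsProbabilityMeasure (q.law x) := by
  unfold law; infer_instance

theorem law_fst_preimage (q : JumpRates S) (x : S) {A : Set (ℕ → S)} (hA : MeasurableSet A) :
    q.law x (Prod.fst ⁻¹' A) = q.chainLaw x A := by
  rw [law]
  exact measurePreserving_fst.measure_preimage hA.nullMeasurableSet

theorem law_ae_pos (q : JumpRates S) (x : S) : ∀ᵐ ω ∂(q.law x), ∀ k, 0 < ω.2 k := by
  rw [ae_all_iff]
  intro k
  have h : ∀ᵐ s ∂(Measure.infinitePi fun _ : ℕ => expMeasure 1), 0 < s k :=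
    (measurePreserving_eval_infinitePi (fun _ : ℕ => expMeasure 1) k).quasiMeasurePreserving.ae
      expMeasure_one_ae_pos
  exact Measure.quasiMeasurePreserving_snd.ae h

theorem isIrreducible_of_reaches (q : JumpRates S) (hq : ∀ y, q.exitRate y ≠ 0)
    (h : ∀ x y, q.Reaches x y) : q.IsIrreducible := by
  intro x y
  rw [pos_iff_ne_zero]
  intro h0
  obtain ⟨n, hn⟩ := (h x y).exists_avoidProb_lt_one
  have h1 : q.law x (Prod.fst ⁻¹' avoidSet y n) = 1 := by
    refine (mem_ae_iff_prob_eq_one (measurable_fst (measurableSet_avoidSet y n))).1 ?_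
    filter_upwards [q.law_ae_pos x, measure_eq_zero_iff_ae_notMem.1 h0] with ω hω hω' i _ _ hi
    exact hω' ⟨_, hi ▸ q.process_jumpTime hq hω i⟩
  rw [q.law_fst_preimage x (measurableSet_avoidSet y n), chainLaw_avoidSet] at h1
  exact hn.ne h1

theorem lintegral_returnTime_lt_top (q : JumpRates S) {r : ℝ≥0} (hr : 0 < r)
    (hq : ∀ y, r ≤ q.exitRate y) {x : S} (hsum : ∑' n, q.avoidProb x n x < ∞) :
    ∫⁻ ω, q.returnTime x ω ∂(q.law x) < ∞ := by
  have hq0 : ∀ y, q.exitRate y ≠ 0 := fun y => (hr.trans_le (hq y)).ne'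
  have hlim := ENNReal.tendsto_atTop_zero_of_tsum_ne_top hsum.ne
  have hret : ∀ᵐ ω ∂(q.law x), ∃ n, ω.1 ∉ avoidSet x n := by
    rw [ae_iff]
    refine le_antisymm (ge_of_tendsto' hlim fun n => ?_) zero_le
    rw [← chainLaw_avoidSet, ← q.law_fst_preimage x (measurableSet_avoidSet x n)]
    exact measure_mono fun ω hω => by
      have : ¬ ∃ n, ω.1 ∉ avoidSet x n := hω
      push Not at this
      exact this n
  have hmeas : ∀ k, Measurable fun Y : ℕ → S =>
      (avoidSet x k).indicator 1 Y / (q.exitRate (Y k) : ℝ≥0∞) := fun k =>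
    (measurable_one.indicator (measurableSet_avoidSet x k)).div
      ((Measurable.of_discrete (f := fun y => (q.exitRate y : ℝ≥0∞))).comp (measurable_pi_apply k))
  have hmeas' : ∀ k, Measurable fun s : ℕ → ℝ => ENNReal.ofReal (s k) := fun k =>
    ENNReal.measurable_ofReal.comp (measurable_pi_apply k)
  set C := ∫⁻ s, ENNReal.ofReal s ∂(expMeasure 1) with hC
  calc ∫⁻ ω, q.returnTime x ω ∂(q.law x)
      ≤ ∫⁻ ω, ∑' k, (avoidSet x k).indicator 1 ω.1 / (q.exitRate (ω.1 k) : ℝ≥0∞)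
        * ENNReal.ofReal (ω.2 k) ∂(q.law x) := by
        refine lintegral_mono_ae ?_
        filter_upwards [q.law_ae_pos x, hret] with ω h1 h2
        exact q.returnTime_le_tsum hq0 h1 h2
    _ = ∑' k, ∫⁻ ω, (avoidSet x k).indicator 1 ω.1 / (q.exitRate (ω.1 k) : ℝ≥0∞)
        * ENNReal.ofReal (ω.2 k) ∂(q.law x) :=
        lintegral_tsum fun k => (((hmeas k).comp measurable_fst).mul
          ((hmeas' k).comp measurable_snd)).aemeasurable
    _ ≤ ∑' k, (r : ℝ≥0∞)⁻¹ * C * q.avoidProb x k x := by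
        refine ENNReal.tsum_le_tsum fun k => ?_
        rw [law, lintegral_prod_mul (hmeas k).aemeasurable (hmeas' k).aemeasurable]
        have hk : ∫⁻ s, ENNReal.ofReal (s k) ∂(Measure.infinitePi fun _ : ℕ => expMeasure 1)
            = C :=
          (measurePreserving_eval_infinitePi (fun _ : ℕ => expMeasure 1) k).lintegral_comp
            ENNReal.measurable_ofReal
        rw [hk, mul_assoc, mul_comm C, ← mul_assoc]
        refine mul_le_mul_left ?_ C
        calc _ ≤ ∫⁻ Y, (r : ℝ≥0∞)⁻¹ * (avoidSet x k).indicator 1 Y ∂(q.chainLaw x) := by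
              refine lintegral_mono fun Y => ?_
              rw [div_eq_mul_inv, mul_comm]
              exact mul_le_mul_left (ENNReal.inv_le_inv.2 (by exact_mod_cast hq _)) _
          _ = (r : ℝ≥0∞)⁻¹ * q.avoidProb x k x := by
              rw [lintegral_const_mul _ (measurable_one.indicator (measurableSet_avoidSet x k)),
                lintegral_indicator_one (measurableSet_avoidSet x k), chainLaw_avoidSet]
    _ < ∞ := by
        rw [ENNReal.tsum_mul_left]
        exact ENNReal.mul_lt_top (ENNReal.mul_lt_top
          (ENNReal.inv_lt_top.2 (by exact_mod_cast hr))
          lintegral_ofReal_expMeasure_one_ne_top.lt_top) hsum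

theorem lintegral_returnTime_eq_top (q : JumpRates S) {o : S} {c : ℝ≥0∞} (hc : 0 < c)
    (h : ∀ n, c ≤ q.avoidProb o n o) : ∫⁻ ω, q.returnTime o ω ∂(q.law o) = ∞ := by
  set A : Set (Sample S) := Prod.fst ⁻¹' ⋂ n, avoidSet o n with hA
  have hmA : MeasurableSet (⋂ n, avoidSet o n) :=
    MeasurableSet.iInter fun n => measurableSet_avoidSet o n
  have hμA : q.law o A ≠ 0 := by
    rw [hA, q.law_fst_preimage o hmA, Antitone.measure_iInter
      (fun m n hmn Y (hY : Y ∈ avoidSet o n) i h1 h2 => hY i h1 (h2.trans hmn))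
      (fun n => (measurableSet_avoidSet o n).nullMeasurableSet) ⟨0, measure_ne_top _ _⟩]
    simp only [chainLaw_avoidSet]
    exact (hc.trans_le (le_iInf h)).ne'
  have htop : ∀ ω ∈ A, q.returnTime o ω = ∞ := by
    intro ω hω
    rw [returnTime, iInf₂_eq_top]
    rintro t ⟨ht, hp⟩
    obtain ⟨n, _, h2, h3⟩ := q.exists_of_process_eq_some hp
    rcases Nat.eq_zero_or_pos n with rfl | hn
    · exact absurd h2 (not_lt.2 ht)
    · exact absurd h3 (Set.mem_iInter.1 hω n n hn le_rfl)
  rw [eq_top_iff]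
  calc ∞ = ∫⁻ _ in A, ∞ ∂(q.law o) := by
        rw [setLIntegral_const, ENNReal.top_mul hμA]
    _ = ∫⁻ ω in A, q.returnTime o ω ∂(q.law o) :=
        (setLIntegral_congr_fun (measurable_fst hmA) fun ω hω => htop ω hω).symm
    _ ≤ _ := setLIntegral_le_lintegral _ _

end Law

end JumpRates

/-! ### The generator of the tandem network -/

section Tandem

variable {lam : ℕ → ℝ≥0} {μ₁ μ₂ : ℝ≥0}

theorem tsum_tandemRate_mul (lam : ℕ → ℝ≥0) (μ₁ μ₂ : ℝ≥0) (x : ℕ × ℕ) (f : ℕ × ℕ → ℝ≥0∞) :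
    ∑' z, ((tandem lam μ₁ μ₂).rate x z : ℝ≥0∞) * f z
      = lam x.2 * f (x.1 + 1, x.2) + (if 0 < x.1 then μ₁ * f (x.1 - 1, x.2 + 1) else 0)
        + (if 0 < x.2 then μ₂ * f (x.1, x.2 - 1) else 0) := by
  have h : ∀ z, ((tandem lam μ₁ μ₂).rate x z : ℝ≥0∞) * f z
      = (if z = (x.1 + 1, x.2) then (lam x.2 : ℝ≥0∞) * f (x.1 + 1, x.2) else 0)
        + (if z = (x.1 - 1, x.2 + 1) then
            (if 0 < x.1 then (μ₁ : ℝ≥0∞) * f (x.1 - 1, x.2 + 1) else 0) else 0)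
        + (if z = (x.1, x.2 - 1) then
            (if 0 < x.2 then (μ₂ : ℝ≥0∞) * f (x.1, x.2 - 1) else 0) else 0) := by
    rintro ⟨a, b⟩
    obtain ⟨c, d⟩ := x
    simp only [tandem, tandemRate, Prod.mk.injEq]
    by_cases h1 : a = c + 1 ∧ b = d
    · obtain ⟨rfl, rfl⟩ := h1
      rw [if_pos ⟨rfl, rfl⟩, if_pos ⟨rfl, rfl⟩, if_neg (by omega), if_neg (by omega)]
      simp
    by_cases h2 : c = a + 1 ∧ b = d + 1
    · obtain ⟨rfl, rfl⟩ := h2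
      rw [if_neg h1, if_pos ⟨rfl, rfl⟩, if_neg h1, if_pos ⟨by omega, rfl⟩, if_pos (by omega),
        if_neg (by omega)]
      simp
    by_cases h3 : a = c ∧ d = b + 1
    · obtain ⟨rfl, rfl⟩ := h3
      rw [if_neg h1, if_neg h2, if_pos ⟨rfl, rfl⟩, if_neg h1, if_neg (by omega),
        if_pos ⟨rfl, by omega⟩, if_pos (by omega)]
      simp
    rw [if_neg h1, if_neg h2, if_neg h3, if_neg h1]
    have e2 : (if a = c - 1 ∧ b = d + 1 then
        (if 0 < c then (μ₁ : ℝ≥0∞) * f (c - 1, d + 1) else 0) else 0) = 0 := by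
      split_ifs <;> first | rfl | omega
    have e3 : (if a = c ∧ b = d - 1 then
        (if 0 < d then (μ₂ : ℝ≥0∞) * f (c, d - 1) else 0) else 0) = 0 := by
      split_ifs <;> first | rfl | omega
    rw [e2, e3]
    simp
  rw [tsum_congr h, ENNReal.tsum_add, ENNReal.tsum_add, tsum_ite_eq, tsum_ite_eq, tsum_ite_eq]

theorem exitRate_tandem (lam : ℕ → ℝ≥0) (μ₁ μ₂ : ℝ≥0) (x : ℕ × ℕ) :
    (tandem lam μ₁ μ₂).exitRate x
      = lam x.2 + (if 0 < x.1 then μ₁ else 0) + (if 0 < x.2 then μ₂ else 0) := by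
  have h := tsum_tandemRate_mul lam μ₁ μ₂ x 1
  simp only [Pi.one_apply, mul_one, JumpRates.tsum_coe_rate] at h
  have : ((tandem lam μ₁ μ₂).exitRate x : ℝ≥0∞)
      = ((lam x.2 + (if 0 < x.1 then μ₁ else 0) + (if 0 < x.2 then μ₂ else 0) : ℝ≥0) : ℝ≥0∞) := by
    rw [h]; push_cast; simp only [apply_ite ((↑) : ℝ≥0 → ℝ≥0∞), ENNReal.coe_zero]
  exact_mod_cast this

theorem le_exitRate_tandem (x : ℕ × ℕ) :
    min (lam 0) μ₂ ≤ (tandem lam μ₁ μ₂).exitRate x := by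
  rw [exitRate_tandem]
  obtain ⟨a, b⟩ := x
  rcases Nat.eq_zero_or_pos b with rfl | hb
  · exact (min_le_left _ _).trans (by simp)
  · rw [if_pos hb]
    exact (min_le_right _ _).trans le_add_self

/-- The generator of the tandem network, acting on real functions. -/
noncomputable def tandemGen (lam : ℕ → ℝ≥0) (μ₁ μ₂ : ℝ≥0) (f : ℕ × ℕ → ℝ) (x : ℕ × ℕ) : ℝ :=
  lam x.2 * (f (x.1 + 1, x.2) - f x)
    + (if 0 < x.1 then μ₁ * (f (x.1 - 1, x.2 + 1) - f x) else 0)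
    + (if 0 < x.2 then μ₂ * (f (x.1, x.2 - 1) - f x) else 0)

theorem tandemGen_add_mul_exitRate (f : ℕ × ℕ → ℝ) (x : ℕ × ℕ) :
    tandemGen lam μ₁ μ₂ f x + f x * (tandem lam μ₁ μ₂).exitRate x
      = lam x.2 * f (x.1 + 1, x.2) + (if 0 < x.1 then μ₁ * f (x.1 - 1, x.2 + 1) else 0)
        + (if 0 < x.2 then μ₂ * f (x.1, x.2 - 1) else 0) := by
  rw [exitRate_tandem, tandemGen]
  push_cast
  split_ifs <;> push_cast <;> ring

theorem tandemGen_mean_nonneg {f : ℕ × ℕ → ℝ} (hf : ∀ z, 0 ≤ f z) {x : ℕ × ℕ}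
    (hx : (0 : ℝ) < (tandem lam μ₁ μ₂).exitRate x) :
    0 ≤ f x + tandemGen lam μ₁ μ₂ f x / (tandem lam μ₁ μ₂).exitRate x := by
  have h : 0 ≤ tandemGen lam μ₁ μ₂ f x + f x * (tandem lam μ₁ μ₂).exitRate x := by
    rw [tandemGen_add_mul_exitRate]
    have h1 := mul_nonneg (lam x.2).coe_nonneg (hf (x.1 + 1, x.2))
    have h2 := mul_nonneg μ₁.coe_nonneg (hf (x.1 - 1, x.2 + 1))
    have h3 := mul_nonneg μ₂.coe_nonneg (hf (x.1, x.2 - 1))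
    split_ifs <;> linarith
  have h' := div_nonneg h hx.le
  rwa [add_div, mul_div_cancel_right₀ _ hx.ne', add_comm] at h'

theorem lintegral_jumpKernel_tandem {x : ℕ × ℕ} (hx : (tandem lam μ₁ μ₂).exitRate x ≠ 0)
    {f : ℕ × ℕ → ℝ} (hf : ∀ z, 0 ≤ f z) :
    ∫⁻ z, ENNReal.ofReal (f z) ∂((tandem lam μ₁ μ₂).jumpKernel x)
      = ENNReal.ofReal (f x + tandemGen lam μ₁ μ₂ f x / (tandem lam μ₁ μ₂).exitRate x) := by
  have hx' : (0 : ℝ) < (tandem lam μ₁ μ₂).exitRate x := by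
    exact_mod_cast pos_iff_ne_zero.2 hx
  have hcoe : ∀ (c : ℝ≥0) z, (c : ℝ≥0∞) * ENNReal.ofReal (f z) = ENNReal.ofReal (c * f z) := by
    intro c z
    rw [ENNReal.ofReal_mul c.coe_nonneg, ENNReal.ofReal_coe_nnreal]
  have hite : ∀ (p : Prop) [Decidable p] (a : ℝ),
      (if p then ENNReal.ofReal a else 0) = ENNReal.ofReal (if p then a else 0) := by
    intro p _ a
    split_ifs <;> simp
  have hnn : ∀ (p : Prop) [Decidable p] (c : ℝ≥0) z, 0 ≤ if p then (c : ℝ) * f z else 0 := by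
    intro p _ c z
    split_ifs
    · exact mul_nonneg c.coe_nonneg (hf z)
    · exact le_rfl
  have h1 := mul_nonneg (lam x.2).coe_nonneg (hf (x.1 + 1, x.2))
  rw [JumpRates.lintegral_jumpKernel _ hx, tsum_tandemRate_mul]
  simp only [hcoe, hite]
  rw [← ENNReal.ofReal_add h1 (hnn _ _ _), ← ENNReal.ofReal_add (add_nonneg h1 (hnn _ _ _))
    (hnn _ _ _), ← ENNReal.ofReal_coe_nnreal, ← ENNReal.ofReal_div_of_pos hx']
  congr 1
  rw [div_eq_iff hx'.ne', add_mul, div_mul_cancel₀ _ hx'.ne', ← tandemGen_add_mul_exitRate,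
    add_comm]

theorem tandem_rate_arrival (hlam : 0 < lam 0) (a : ℕ) :
    0 < (tandem lam μ₁ μ₂).rate (a, 0) (a + 1, 0) := by
  simpa [tandem, tandemRate] using hlam

theorem tandem_rate_transfer (hμ₁ : 0 < μ₁) (a b : ℕ) :
    0 < (tandem lam μ₁ μ₂).rate (a + 1, b) (a, b + 1) := by
  simpa [tandem, tandemRate] using hμ₁

theorem tandem_rate_departure (hμ₂ : 0 < μ₂) (a b : ℕ) :
    0 < (tandem lam μ₁ μ₂).rate (a, b + 1) (a, b) := by
  simpa [tandem, tandemRate] using hμ₂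

/-- Any two states communicate: empty the network, let customers arrive while the second queue is
empty, and transfer some of them. -/
theorem tandem_reaches (hlam : 0 < lam 0) (hμ₁ : 0 < μ₁) (hμ₂ : 0 < μ₂) (x y : ℕ × ℕ) :
    (tandem lam μ₁ μ₂).Reaches x y := by
  let R : ℕ × ℕ → ℕ × ℕ → Prop := fun x y => 0 < (tandem lam μ₁ μ₂).rate x y
  have h1 : ∀ c a b, Relation.ReflTransGen R (a + c, b) (a, b + c) := by
    intro c
    induction c with
    | zero => exact fun a b => .refl
    | succ c ih =>
      intro a b
      refine .head (tandem_rate_transfer hμ₁ (a + c) b) ?_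
      have := ih a (b + 1)
      rwa [add_assoc, add_comm 1 c] at this
  have h2 : ∀ n, Relation.ReflTransGen R (0, n) (0, 0) := by
    intro n
    induction n with
    | zero => exact .refl
    | succ n ih => exact .head (tandem_rate_departure hμ₂ 0 n) ih
  have h3 : ∀ n, Relation.ReflTransGen R (0, 0) (n, 0) := by
    intro n
    induction n with
    | zero => exact .refl
    | succ n ih => exact .tail ih (tandem_rate_arrival hlam n)
  have h4 : Relation.TransGen R (0, 0) (0, 0) := by
    have e1 : R (0, 0) (1, 0) := tandem_rate_arrival hlam 0
    have e2 : R (1, 0) (0, 1) := tandem_rate_transfer hμ₁ 0 0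
    have e3 : R (0, 1) (0, 0) := tandem_rate_departure hμ₂ 0 0
    exact ((Relation.TransGen.single e1).tail e2).tail e3
  obtain ⟨a, b⟩ := x
  obtain ⟨c, d⟩ := y
  have h5 := (h1 a 0 b)
  rw [zero_add] at h5
  have h6 := (h1 d c 0)
  rw [zero_add] at h6
  exact Relation.TransGen.trans_left
    (Relation.TransGen.trans_right (h5.trans (h2 _)) h4) ((h3 _).trans h6)

/-- Foster's criterion for the tandem network. The drift is compared with the total exit rate and
not with a constant, so that the embedded jump chain has drift `-ε` even if `λ` is unbounded. -/
theorem isStableTandem_of_drift (hlam : 0 < lam 0) (hμ₂ : 0 < μ₂) (hμ : μ₂ ≤ μ₁)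
    (F : Finset (ℕ × ℕ)) {V : ℕ × ℕ → ℝ} (hV : ∀ z, 0 ≤ V z) {ε : ℝ} (hε : 0 < ε)
    (hdrift : ∀ x ∉ F, tandemGen lam μ₁ μ₂ V x ≤ -ε * (tandem lam μ₁ μ₂).exitRate x) :
    IsStableTandem lam μ₁ μ₂ := by
  set q := tandem lam μ₁ μ₂ with hq
  have hreach : ∀ x y, q.Reaches x y := tandem_reaches hlam (hμ₂.trans_le hμ) hμ₂
  have hr : 0 < min (lam 0) μ₂ := lt_min hlam hμ₂
  have hpos : ∀ x, q.exitRate x ≠ 0 := fun x => (hr.trans_le (le_exitRate_tandem x)).ne'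
  refine ⟨q.isIrreducible_of_reaches hpos hreach, fun x => Or.inr ?_⟩
  refine q.lintegral_returnTime_lt_top hr le_exitRate_tandem ?_
  -- on the exceptional set the drift is only bounded, by `M`
  set M : ℝ≥0∞ := ∑ y ∈ F, ∫⁻ z, ENNReal.ofReal (V z) ∂(q.jumpKernel y) + ENNReal.ofReal ε
    with hM
  refine q.tsum_avoidProb_lt_top F (fun y _ => hreach y x) (fun z => ENNReal.ofReal (V z))
    ENNReal.ofReal_ne_top (ε := ENNReal.ofReal ε) (M := M) (ENNReal.ofReal_pos.2 hε).ne'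
    ENNReal.ofReal_ne_top ?_ fun y => ?_
  · refine ENNReal.add_ne_top.2 ⟨ENNReal.sum_ne_top.2 fun y _ => ?_, ENNReal.ofReal_ne_top⟩
    rw [hq, lintegral_jumpKernel_tandem (hpos y) hV]
    exact ENNReal.ofReal_ne_top
  · by_cases hy : y ∈ F
    · rw [Set.indicator_of_mem (by exact_mod_cast hy), Pi.one_apply, mul_one]
      refine le_add_left (add_le_add ?_ le_rfl)
      exact Finset.single_le_sum
        (f := fun y => ∫⁻ z, ENNReal.ofReal (V z) ∂(q.jumpKernel y)) (fun _ _ => zero_le) hy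
    · rw [Set.indicator_of_notMem (by exact_mod_cast hy), mul_zero, add_zero]
      have hy' : (0 : ℝ) < q.exitRate y := by exact_mod_cast pos_iff_ne_zero.2 (hpos y)
      have hd : tandemGen lam μ₁ μ₂ V y / q.exitRate y ≤ -ε := (div_le_iff₀ hy').2 (hdrift y hy)
      have hnn := tandemGen_mean_nonneg hV hy'
      rw [hq, lintegral_jumpKernel_tandem (hpos y) hV, ← ENNReal.ofReal_add hnn hε.le]
      exact ENNReal.ofReal_le_ofReal (by linarith)

/-- A superharmonic function off a set containing the empty state, which is small at some state
`(m, 0)`, makes the network transient. -/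
theorem not_isStableTandem_of_superharmonic (hlam : 0 < lam 0) (hμ₂ : 0 < μ₂)
    {F : Set (ℕ × ℕ)} (hF : (0, 0) ∈ F) {φ : ℕ × ℕ → ℝ} (hφ : ∀ z, 0 ≤ φ z)
    (hφF : ∀ x ∈ F, 1 ≤ φ x) (hgen : ∀ x ∉ F, tandemGen lam μ₁ μ₂ φ x ≤ 0) {m : ℕ}
    (hm : φ (m, 0) < 1) : ¬ IsStableTandem lam μ₁ μ₂ := by
  rintro ⟨-, hrec⟩
  set q := tandem lam μ₁ μ₂ with hq
  have hr : 0 < min (lam 0) μ₂ := lt_min hlam hμ₂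
  have hpos : ∀ x, q.exitRate x ≠ 0 := fun x => (hr.trans_le (le_exitRate_tandem x)).ne'
  have hone : ∀ n y, 1 ≤ q.avoidProb (0, 0) n y + ENNReal.ofReal (φ y) := by
    refine q.one_le_avoidProb_add hF (fun y hy => ?_) fun y hy => ?_
    · rw [← ENNReal.ofReal_one]
      exact ENNReal.ofReal_le_ofReal (hφF y hy)
    · rw [hq, lintegral_jumpKernel_tandem (hpos y) hφ]
      refine ENNReal.ofReal_le_ofReal ?_
      have := div_nonpos_of_nonpos_of_nonneg (hgen y hy) (q.exitRate y).coe_nonneg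
      linarith
  have hstart : ∃ c, 0 < c ∧ ∀ n, c ≤ q.avoidProb (0, 0) n (m, 0) :=
    ⟨1 - ENNReal.ofReal (φ (m, 0)), tsub_pos_of_lt (ENNReal.ofReal_lt_one.2 hm),
      fun n => tsub_le_iff_right.2 (hone n _)⟩
  have hback : ∃ c, 0 < c ∧ ∀ n, c ≤ q.avoidProb (0, 0) n (0, 0) := by
    have hdown : ∀ k, (∃ c, 0 < c ∧ ∀ n, c ≤ q.avoidProb (0, 0) n (k, 0)) →
        ∃ c, 0 < c ∧ ∀ n, c ≤ q.avoidProb (0, 0) n (0, 0) := by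
      intro k
      induction k with
      | zero => exact id
      | succ k ih =>
        exact fun h => ih (q.exists_le_avoidProb_of_rate_pos (tandem_rate_arrival hlam k)
          (by simp) h)
    exact hdown m hstart
  obtain ⟨c, hc, hle⟩ := hback
  rcases hrec (0, 0) with h | h
  · exact hpos _ h
  · exact h.ne (q.lintegral_returnTime_eq_top hc hle)

end Tandem

/-! ### Stability -/

section Stability

variable {lam : ℕ → ℝ≥0} {μ₁ μ₂ : ℝ≥0}

/-- The generator applied to `x₁ + g(x₂) + B`, in terms of the increments `h` of `g`. -/
theorem tandemGen_add_sum (h : ℕ → ℝ) (B : ℝ) (x : ℕ × ℕ) :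
    tandemGen lam μ₁ μ₂ (fun x => x.1 + ∑ j ∈ Finset.range x.2, h j + B) x
      = lam x.2 + (if 0 < x.1 then μ₁ * (h x.2 - 1) else 0)
        - (if 0 < x.2 then μ₂ * h (x.2 - 1) else 0) := by
  obtain ⟨a, b⟩ := x
  rw [tandemGen]
  rcases Nat.eq_zero_or_pos a with rfl | ha <;> rcases Nat.eq_zero_or_pos b with rfl | hb
  · simp
  · obtain ⟨b, rfl⟩ := Nat.exists_eq_add_of_lt hb
    simp [Finset.sum_range_succ]
    ring
  · obtain ⟨a, rfl⟩ := Nat.exists_eq_add_of_lt ha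
    simp
  · obtain ⟨a, rfl⟩ := Nat.exists_eq_add_of_lt ha
    obtain ⟨b, rfl⟩ := Nat.exists_eq_add_of_lt hb
    simp [Finset.sum_range_succ]
    ring

theorem exists_neg_le_sum_range {h : ℕ → ℝ} {m : ℕ} (hm : ∀ n, m ≤ n → 0 ≤ h n) :
    ∃ B, ∀ n, 0 ≤ ∑ j ∈ Finset.range n, h j + B := by
  refine ⟨∑ j ∈ Finset.range m, |h j|, fun n => ?_⟩
  have h1 : ∀ j, -(if j < m then |h j| else 0) ≤ h j := by
    intro j
    split_ifs with hj
    · exact neg_abs_le _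
    · simpa using hm j (not_lt.1 hj)
  have h2 : ∑ j ∈ Finset.range n, (if j < m then |h j| else 0) ≤ ∑ j ∈ Finset.range m, |h j| := by
    rw [← Finset.sum_filter]
    refine Finset.sum_le_sum_of_subset_of_nonneg (fun j hj => ?_) fun _ _ _ => abs_nonneg _
    exact Finset.mem_range.2 (Finset.mem_filter.1 hj).2
  have h3 := Finset.sum_le_sum fun j (_ : j ∈ Finset.range n) => h1 j
  rw [Finset.sum_neg_distrib] at h3
  linarith

/-- The increments `h` of the function `g` for which `x₁ + g(x₂)` has drift
`-ε (λ(x₂) + μ₁ + μ₂)` at all `x` with `x₁ > 0`. -/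
noncomputable def lyapunovSlope (lam : ℕ → ℝ≥0) (μ₁ μ₂ : ℝ≥0) (ε : ℝ) : ℕ → ℝ
  | 0 => (μ₁ - ε * (μ₁ + μ₂) - (1 + ε) * lam 0) / μ₁
  | n + 1 => (μ₂ * lyapunovSlope lam μ₁ μ₂ ε n + μ₁ - ε * (μ₁ + μ₂) - (1 + ε) * lam (n + 1)) / μ₁

theorem mul_lyapunovSlope (hμ₁ : 0 < μ₁) (ε : ℝ) (n : ℕ) :
    (μ₁ : ℝ) * lyapunovSlope lam μ₁ μ₂ ε n
      = (if 0 < n then μ₂ * lyapunovSlope lam μ₁ μ₂ ε (n - 1) else 0)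
        + μ₁ - ε * (μ₁ + μ₂) - (1 + ε) * lam n := by
  have h : (μ₁ : ℝ) ≠ 0 := by exact_mod_cast hμ₁.ne'
  cases n with
  | zero => rw [lyapunovSlope, mul_div_cancel₀ _ h]; simp
  | succ n => rw [lyapunovSlope, mul_div_cancel₀ _ h]; simp

theorem mul_pow_mul_lyapunovSlope (hμ₁ : 0 < μ₁) (hμ₂ : 0 < μ₂) (ε : ℝ) (n : ℕ) :
    (μ₁ : ℝ) * (μ₁ / μ₂ : ℝ) ^ n * lyapunovSlope lam μ₁ μ₂ ε n
      = (μ₁ - ε * (μ₁ + μ₂)) * ∑ j ∈ Finset.range (n + 1), (μ₁ / μ₂ : ℝ) ^ j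
        - (1 + ε) * ∑ j ∈ Finset.range (n + 1), (μ₁ / μ₂ : ℝ) ^ j * lam j := by
  have h2 : (μ₂ : ℝ) ≠ 0 := by exact_mod_cast hμ₂.ne'
  have hz : (μ₁ / μ₂ : ℝ) * μ₂ = μ₁ := div_mul_cancel₀ _ h2
  set z : ℝ := μ₁ / μ₂ with hzdef
  induction n with
  | zero =>
    have := mul_lyapunovSlope (lam := lam) (μ₂ := μ₂) hμ₁ ε 0
    simp at this ⊢
    linarith
  | succ n ih =>
    have h := mul_lyapunovSlope (lam := lam) (μ₂ := μ₂) hμ₁ ε (n + 1)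
    rw [if_pos n.succ_pos, Nat.add_sub_cancel] at h
    rw [Finset.sum_range_succ _ (n + 1), Finset.sum_range_succ _ (n + 1)]
    calc _ = z ^ (n + 1) * (μ₁ * lyapunovSlope lam μ₁ μ₂ ε (n + 1)) := by ring
      _ = z * μ₂ * z ^ n * lyapunovSlope lam μ₁ μ₂ ε n
          + z ^ (n + 1) * (μ₁ - ε * (μ₁ + μ₂) - (1 + ε) * lam (n + 1)) := by rw [h]; ring
      _ = _ := by rw [hz, ih]; ring

/-- The Lyapunov function is increasing for large `x₂`: by the closed form of its slope, the
geometric mean of `λ` being at most `d < μ₂` leaves a slope of at least `1`. -/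
theorem eventually_one_le_lyapunovSlope (hμ₂ : 0 < μ₂) (hμ : μ₂ ≤ μ₁) {d ε : ℝ} (hd : d < μ₂)
    (hε : 0 < ε) (hεd : ε * (μ₁ + μ₂ + d) ≤ (μ₂ - d) / 2)
    (hmean : ∀ᶠ n in atTop, ∑ j ∈ Finset.range (n + 1), (μ₁ / μ₂ : ℝ) ^ j * lam j
      ≤ d * ∑ j ∈ Finset.range (n + 1), (μ₁ / μ₂ : ℝ) ^ j) :
    ∀ᶠ n in atTop, 1 ≤ lyapunovSlope lam μ₁ μ₂ ε n := by
  have h1 : (0 : ℝ) < μ₁ := by exact_mod_cast hμ₂.trans_le hμ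
  have h2 : (0 : ℝ) < μ₂ := by exact_mod_cast hμ₂
  have h12 : (μ₂ : ℝ) ≤ μ₁ := by exact_mod_cast hμ
  obtain ⟨N, hN⟩ := exists_nat_ge ((μ₂ : ℝ) / ((μ₂ - d) / 2))
  filter_upwards [hmean, eventually_ge_atTop N] with n hn hNn
  have key := mul_pow_mul_lyapunovSlope (lam := lam) (hμ₂.trans_le hμ) hμ₂ ε n
  have hz : (μ₁ / μ₂ : ℝ) * μ₂ = μ₁ := div_mul_cancel₀ _ h2.ne'
  have hz1 : 1 ≤ (μ₁ / μ₂ : ℝ) := (one_le_div h2).2 h12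
  have hgeom := mul_geom_sum (μ₁ / μ₂ : ℝ) (n + 1)
  have hpow : (0 : ℝ) < (μ₁ / μ₂ : ℝ) ^ n := by positivity
  have hSn : (N : ℝ) ≤ ∑ j ∈ Finset.range (n + 1), (μ₁ / μ₂ : ℝ) ^ j := by
    calc (N : ℝ) ≤ ((n + 1 : ℕ) : ℝ) := by exact_mod_cast hNn.trans n.le_succ
      _ = ∑ j ∈ Finset.range (n + 1), (1 : ℝ) := by simp
      _ ≤ _ := Finset.sum_le_sum fun j _ => one_le_pow₀ hz1
  set z : ℝ := μ₁ / μ₂ with hzdef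
  set T := ∑ j ∈ Finset.range (n + 1), z ^ j with hT
  set A := ∑ j ∈ Finset.range (n + 1), z ^ j * lam j with hA
  have hTpos : 0 ≤ T := Finset.sum_nonneg fun j _ => by positivity
  have hT2 : (μ₂ : ℝ) ≤ (μ₂ - d) / 2 * T := by
    have := (div_le_iff₀ (by linarith : (0 : ℝ) < (μ₂ - d) / 2)).1 (hN.trans hSn)
    linarith
  -- the geometric sum gives `(μ₁ - μ₂) T = μ₁ zⁿ - μ₂`
  have hT1 : (μ₁ - μ₂ : ℝ) * T = μ₁ * z ^ n - μ₂ := by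
    calc (μ₁ - μ₂ : ℝ) * T = μ₂ * ((z - 1) * T) := by rw [← hz]; ring
      _ = z * μ₂ * z ^ n - μ₂ := by rw [hgeom]; ring
      _ = _ := by rw [hz]
  have hA2 : (1 + ε) * A ≤ (1 + ε) * (d * T) := mul_le_mul_of_nonneg_left hn (by linarith)
  have hε2 : ε * (μ₁ + μ₂ + d) * T ≤ (μ₂ - d) / 2 * T := mul_le_mul_of_nonneg_right hεd hTpos
  have hfin : μ₁ * z ^ n * 1 ≤ μ₁ * z ^ n * lyapunovSlope lam μ₁ μ₂ ε n := by
    rw [key]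
    nlinarith
  exact le_of_mul_le_mul_left hfin (by positivity)

theorem isStableTandem_of_geometric_mean (hlam : 0 < lam 0) (hμ₂ : 0 < μ₂) (hμ : μ₂ ≤ μ₁) {d : ℝ}
    (hd0 : 0 ≤ d) (hd : d < μ₂)
    (hmean : ∀ᶠ n in atTop, ∑ j ∈ Finset.range (n + 1), (μ₁ / μ₂ : ℝ) ^ j * lam j
      ≤ d * ∑ j ∈ Finset.range (n + 1), (μ₁ / μ₂ : ℝ) ^ j) : IsStableTandem lam μ₁ μ₂ := by
  have h1 : (0 : ℝ) < μ₁ := by exact_mod_cast hμ₂.trans_le hμ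
  have h2 : (0 : ℝ) < μ₂ := by exact_mod_cast hμ₂
  set ε : ℝ := (μ₂ - d) / 2 / (μ₁ + μ₂ + d) with hεdef
  have hε : 0 < ε := by
    have : (0 : ℝ) < μ₂ - d := by linarith
    positivity
  have hεd : ε * (μ₁ + μ₂ + d) = (μ₂ - d) / 2 := div_mul_cancel₀ _ (by positivity)
  obtain ⟨m, hm⟩ := eventually_atTop.1
    (eventually_one_le_lyapunovSlope hμ₂ hμ hd hε hεd.le hmean)
  set h := lyapunovSlope lam μ₁ μ₂ ε with hh
  obtain ⟨B, hB⟩ := exists_neg_le_sum_range (h := h) (m := m)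
    fun n hn => zero_le_one.trans (hm n hn)
  refine isStableTandem_of_drift hlam hμ₂ hμ ({0} ×ˢ Finset.range (m + 1))
    (V := fun x => x.1 + ∑ j ∈ Finset.range x.2, h j + B)
    (fun z => by have := hB z.2; have : (0 : ℝ) ≤ z.1 := z.1.cast_nonneg; linarith) hε ?_
  rintro ⟨a, n⟩ hx
  have hrec := mul_lyapunovSlope (lam := lam) (μ₂ := μ₂) (hμ₂.trans_le hμ) ε n
  rw [← hh] at hrec
  have hexit : ε * ((tandem lam μ₁ μ₂).exitRate (a, n) : ℝ) ≤ ε * (lam n + μ₁ + μ₂) := by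
    refine mul_le_mul_of_nonneg_left ?_ hε.le
    rw [exitRate_tandem]
    push_cast
    have e1 : ((if 0 < a then μ₁ else 0 : ℝ≥0) : ℝ) ≤ μ₁ := by split_ifs <;> simp
    have e2 : ((if 0 < n then μ₂ else 0 : ℝ≥0) : ℝ) ≤ μ₂ := by split_ifs <;> simp
    linarith
  rw [tandemGen_add_sum]
  dsimp only
  rcases Nat.eq_zero_or_pos a with rfl | ha
  · have hmn : m ≤ n := by
      simp only [Finset.mem_product, Finset.mem_singleton, Finset.mem_range, true_and] at hx
      omega
    -- the missing transfers cost `μ₁ (h n - 1)`, which is nonnegative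
    have := mul_le_mul_of_nonneg_left (hm n hmn) h1.le
    simp only [lt_self_iff_false, if_false]
    linarith
  · rw [if_pos ha]
    linarith

end Stability

/-! ### Instability -/

section Instability

variable {lam : ℕ → ℝ≥0} {μ₁ μ₂ : ℝ≥0}

/-- A bounded perturbation `κ ≥ 0` of the slope `1` for which `x₁ + ∑_{1 ≤ j ≤ x₂} (1 + κ(j))` has
drift at least `ε` at all `x` with `x₁ > 0`, if the arrival rate is at least `μ₂ + 2 ε` at the
levels from `n₀` on. It increases by `1 + ε / μ₂` at each step up to the level `n₀`, which makes up
for a vanishing arrival rate, and then decreases to `0` in steps of `ε / μ₁`. -/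
noncomputable def slopeExcess (n₀ : ℕ) (ε : ℝ) (μ₁ μ₂ : ℝ≥0) (n : ℕ) : ℝ :=
  if n ≤ n₀ then (ε + μ₂) / μ₂ * n
  else max 0 ((ε + μ₂) / μ₂ * n₀ - ε / μ₁ * (n - n₀))

theorem slopeExcess_nonneg (n₀ : ℕ) {ε : ℝ} (hε : 0 < ε) (n : ℕ) :
    0 ≤ slopeExcess n₀ ε μ₁ μ₂ n := by
  unfold slopeExcess
  split_ifs
  · positivity
  · exact le_max_left _ _

theorem slopeExcess_le (n₀ : ℕ) {ε : ℝ} (hε : 0 < ε) (n : ℕ) :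
    slopeExcess n₀ ε μ₁ μ₂ n ≤ (ε + μ₂) / μ₂ * n₀ := by
  unfold slopeExcess
  split_ifs with h
  · gcongr
  · have h' : (n₀ : ℝ) ≤ n := by exact_mod_cast (not_le.1 h).le
    have : 0 ≤ ε / μ₁ * ((n : ℝ) - n₀) := mul_nonneg (by positivity) (sub_nonneg.2 h')
    exact max_le (by positivity) (by linarith)

theorem slopeExcess_of_ge {n₀ : ℕ} {ε : ℝ} {n : ℕ} (h : n₀ ≤ n) (hε : 0 < ε) :
    slopeExcess n₀ ε μ₁ μ₂ n = max 0 ((ε + μ₂) / μ₂ * n₀ - ε / μ₁ * (n - n₀)) := by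
  rcases h.eq_or_lt with rfl | h
  · rw [slopeExcess, if_pos le_rfl, sub_self, mul_zero, sub_zero, max_eq_right (by positivity)]
  · rw [slopeExcess, if_neg (not_le.2 h)]

theorem exists_slopeExcess_eq_zero (hμ₁ : 0 < μ₁) (n₀ : ℕ) {ε : ℝ} (hε : 0 < ε) :
    ∃ n₁, n₀ ≤ n₁ ∧ ∀ n, n₁ ≤ n → slopeExcess n₀ ε μ₁ μ₂ n = 0 := by
  have h1 : (0 : ℝ) < μ₁ := by exact_mod_cast hμ₁
  obtain ⟨N, hN⟩ := exists_nat_ge ((ε + μ₂) / μ₂ * n₀ / (ε / μ₁))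
  refine ⟨n₀ + N, Nat.le_add_right _ _, fun n hn => ?_⟩
  rw [slopeExcess_of_ge (by omega) hε]
  refine max_eq_left ?_
  have hN' := (div_le_iff₀ (by positivity : 0 < ε / (μ₁ : ℝ))).1 hN
  have hn' : (N : ℝ) ≤ n - n₀ := by
    have : ((n₀ + N : ℕ) : ℝ) ≤ n := by exact_mod_cast hn
    push_cast at this
    linarith
  have := mul_le_mul_of_nonneg_right hn' (by positivity : 0 ≤ ε / (μ₁ : ℝ))
  linarith

/-- The drift inequality which `slopeExcess` is made for. -/
theorem le_add_mul_slopeExcess_sub (hμ₂ : 0 < μ₂) (hμ : μ₂ ≤ μ₁) {n₀ : ℕ} {ε : ℝ} (hε : 0 < ε)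
    (n : ℕ) : ε ≤ (if n < n₀ then 0 else μ₂ + 2 * ε) + μ₁ * slopeExcess n₀ ε μ₁ μ₂ (n + 1)
      - μ₂ * (1 + slopeExcess n₀ ε μ₁ μ₂ n) := by
  have h1 : (0 : ℝ) < μ₁ := by exact_mod_cast hμ₂.trans_le hμ
  have h2 : (0 : ℝ) < μ₂ := by exact_mod_cast hμ₂
  have h12 : (μ₂ : ℝ) ≤ μ₁ := by exact_mod_cast hμ
  split_ifs with h
  · have e0 : slopeExcess n₀ ε μ₁ μ₂ n = (ε + μ₂) / μ₂ * n := by rw [slopeExcess, if_pos h.le]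
    have e1 : slopeExcess n₀ ε μ₁ μ₂ (n + 1) = (ε + μ₂) / μ₂ * n + (ε + μ₂) / μ₂ := by
      rw [slopeExcess, if_pos (Nat.succ_le_of_lt h)]; push_cast; ring
    have e2 : μ₂ * ((ε + μ₂) / μ₂) = ε + μ₂ := mul_div_cancel₀ _ h2.ne'
    have e3 : 0 ≤ (ε + μ₂) / μ₂ * n + (ε + μ₂) / μ₂ := by positivity
    have e4 := mul_le_mul_of_nonneg_right h12 e3
    rw [e0, e1]
    nlinarith
  · have hn := not_lt.1 h
    have hk := slopeExcess_nonneg (μ₁ := μ₁) (μ₂ := μ₂) n₀ hε n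
    have hstep : slopeExcess n₀ ε μ₁ μ₂ n - ε / μ₁ ≤ slopeExcess n₀ ε μ₁ μ₂ (n + 1) := by
      rw [slopeExcess_of_ge hn hε, slopeExcess_of_ge (by omega) hε, sub_le_iff_le_add]
      have : 0 < ε / (μ₁ : ℝ) := by positivity
      refine max_le (add_nonneg (le_max_left _ _) this.le) ?_
      refine le_trans (le_of_eq ?_) (add_le_add_left (le_max_right _ _) _)
      push_cast
      ring
    have e1 := mul_le_mul_of_nonneg_left hstep h1.le
    have e2 : μ₁ * (ε / μ₁) = ε := mul_div_cancel₀ _ h1.ne'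
    have e3 := mul_le_mul_of_nonneg_right h12 hk
    linarith

theorem exp_sub_one_le {u : ℝ} (hu : |u| ≤ 1) : Real.exp u - 1 ≤ u + u ^ 2 := by
  have := (abs_le.1 (Real.abs_exp_sub_one_sub_id_le hu)).2
  linarith

/-- The generator applied to an exponential of `x₁ + g(x₂)`, where `1 + κ (n + 1)` is the increment
of `g` from `n` to `n + 1`. -/
theorem tandemGen_exp (κ : ℕ → ℝ) (s G : ℝ) (x : ℕ × ℕ) :
    tandemGen lam μ₁ μ₂
        (fun x => Real.exp (s * (G - (x.1 + ∑ j ∈ Finset.range x.2, (1 + κ (j + 1)))))) x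
      = Real.exp (s * (G - (x.1 + ∑ j ∈ Finset.range x.2, (1 + κ (j + 1)))))
        * (lam x.2 * (Real.exp (-s) - 1)
          + (if 0 < x.1 then μ₁ * (Real.exp (-(s * κ (x.2 + 1))) - 1) else 0)
          + (if 0 < x.2 then μ₂ * (Real.exp (s * (1 + κ x.2)) - 1) else 0)) := by
  obtain ⟨a, b⟩ := x
  rw [tandemGen]
  dsimp only
  set E := Real.exp (s * (G - (a + ∑ j ∈ Finset.range b, (1 + κ (j + 1))))) with hE
  have e1 : Real.exp (s * (G - ((a + 1 : ℕ) + ∑ j ∈ Finset.range b, (1 + κ (j + 1)))))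
      = E * Real.exp (-s) := by
    rw [hE, ← Real.exp_add]; congr 1; push_cast; ring
  have e2 : 0 < a → Real.exp (s * (G - ((a - 1 : ℕ)
      + ∑ j ∈ Finset.range (b + 1), (1 + κ (j + 1))))) = E * Real.exp (-(s * κ (b + 1))) := by
    intro ha
    rw [hE, ← Real.exp_add, Finset.sum_range_succ, Nat.cast_sub ha]; congr 1; push_cast; ring
  have e3 : 0 < b → Real.exp (s * (G - (a + ∑ j ∈ Finset.range (b - 1), (1 + κ (j + 1)))))
      = E * Real.exp (s * (1 + κ b)) := by
    intro hb
    obtain ⟨b, rfl⟩ := Nat.exists_eq_add_of_lt hb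
    rw [hE, ← Real.exp_add]
    simp only [zero_add, Nat.add_sub_cancel, Finset.sum_range_succ]
    congr 1
    ring
  rw [e1]
  split_ifs with ha hb hb
  · rw [e2 ha, e3 hb]; ring
  · rw [e2 ha]; ring
  · rw [e3 hb]; ring
  · ring

/-- If the arrival rate is eventually above `μ₂` by a margin, a small exponential
`exp (-s (x₁ + g(x₂)))` is superharmonic off a finite set. -/
theorem not_isStableTandem_of_eventually_le (hlam : 0 < lam 0) (hμ₂ : 0 < μ₂) (hμ : μ₂ ≤ μ₁)
    {ε : ℝ} (hε : 0 < ε) {n₀ : ℕ} (hn₀ : ∀ n, n₀ ≤ n → μ₂ + 2 * ε ≤ lam n) :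
    ¬ IsStableTandem lam μ₁ μ₂ := by
  have h1 : (0 : ℝ) < μ₁ := by exact_mod_cast hμ₂.trans_le hμ
  have h2 : (0 : ℝ) < μ₂ := by exact_mod_cast hμ₂
  set κ : ℕ → ℝ := slopeExcess n₀ ε μ₁ μ₂ with hκdef
  have hκ0 : ∀ n, 0 ≤ κ n := slopeExcess_nonneg n₀ hε
  set H : ℝ := 1 + (ε + μ₂) / μ₂ * n₀ with hH
  have hH1 : 1 ≤ H := le_add_of_nonneg_right (by positivity)
  have hκH : ∀ n, 1 + κ n ≤ H := fun n => by
    have := slopeExcess_le (μ₁ := μ₁) (μ₂ := μ₂) n₀ hε n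
    linarith
  obtain ⟨n₁, hn₁, hκ1⟩ := exists_slopeExcess_eq_zero (μ₂ := μ₂) (hμ₂.trans_le hμ) n₀ hε
  -- `s` is so small that the second order terms, at most `s² Q`, are dominated by the drift `s ε`
  set Q : ℝ := (μ₂ + 2 * ε) + (μ₁ + μ₂) * H ^ 2 with hQ
  have hQpos : 0 < Q := by positivity
  set s : ℝ := min (1 / H) (ε / Q) with hs
  have hs0 : 0 < s := lt_min (by positivity) (by positivity)
  have hsH : s * H ≤ 1 := (le_div_iff₀ (by linarith)).1 (min_le_left _ _)
  have hsQ : s * Q ≤ ε := (le_div_iff₀ hQpos).1 (min_le_right _ _)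
  have hs1 : s ≤ 1 := (le_mul_of_one_le_right hs0.le hH1).trans hsH
  set g : ℕ → ℝ := fun n => ∑ j ∈ Finset.range n, (1 + κ (j + 1)) with hg
  have hgmono : Monotone g := monotone_nat_of_le_succ fun n => by
    simp only [hg, Finset.sum_range_succ]
    have := hκ0 (n + 1)
    linarith
  obtain ⟨m, hm⟩ := exists_nat_gt (g n₁)
  refine not_isStableTandem_of_superharmonic hlam hμ₂ (F := {x | x.1 = 0 ∧ x.2 ≤ n₁}) (m := m)
    (φ := fun x => Real.exp (s * (g n₁ - (x.1 + g x.2)))) ⟨rfl, Nat.zero_le _⟩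
    (fun z => (Real.exp_pos _).le) ?_ ?_ ?_
  · rintro ⟨a, n⟩ ⟨ha, hn⟩
    dsimp only at ha hn
    rw [ha, Nat.cast_zero, zero_add]
    exact Real.one_le_exp (mul_nonneg hs0.le (sub_nonneg.2 (hgmono hn)))
  · rintro ⟨a, n⟩ hx
    rw [tandemGen_exp]
    refine mul_nonpos_of_nonneg_of_nonpos (Real.exp_pos _).le ?_
    dsimp only
    set ℓ : ℝ := if n < n₀ then 0 else μ₂ + 2 * ε with hℓ
    have hℓ0 : 0 ≤ ℓ := by rw [hℓ]; split_ifs <;> positivity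
    have hℓle : ℓ ≤ μ₂ + 2 * ε := by
      rw [hℓ]; split_ifs
      · positivity
      · exact le_rfl
    have hℓlam : ℓ ≤ lam n := by
      rw [hℓ]; split_ifs with h
      · exact (lam n).coe_nonneg
      · exact hn₀ n (not_lt.1 h)
    have hexps : Real.exp (-s) - 1 ≤ -s + s ^ 2 := by
      have := exp_sub_one_le (u := -s) (by rw [abs_neg, abs_of_pos hs0]; exact hs1)
      rwa [neg_sq] at this
    have harr : lam n * (Real.exp (-s) - 1) ≤ ℓ * (-s + s ^ 2) := by
      have hneg : Real.exp (-s) - 1 ≤ 0 := by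
        have := Real.exp_le_one_iff.2 (neg_nonpos.2 hs0.le)
        linarith
      exact (mul_le_mul_of_nonpos_right hℓlam hneg).trans (mul_le_mul_of_nonneg_left hexps hℓ0)
    have hbound : ∀ u, 0 ≤ u → u ≤ H → (s * u) ^ 2 ≤ s ^ 2 * H ^ 2 ∧ |s * u| ≤ 1 := by
      intro u hu huH
      have h3 : s * u ≤ s * H := mul_le_mul_of_nonneg_left huH hs0.le
      have h4 : 0 ≤ s * u := mul_nonneg hs0.le hu
      exact ⟨by rw [← mul_pow]; exact pow_le_pow_left₀ h4 h3 2,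
        by rw [abs_of_nonneg h4]; exact h3.trans hsH⟩
    have htrans : μ₁ * (Real.exp (-(s * κ (n + 1))) - 1)
        ≤ μ₁ * (-(s * κ (n + 1)) + s ^ 2 * H ^ 2) := by
      obtain ⟨h3, h4⟩ := hbound (κ (n + 1)) (hκ0 _) (by linarith [hκH (n + 1)])
      have h5 := exp_sub_one_le (u := -(s * κ (n + 1))) (by rwa [abs_neg])
      rw [neg_sq] at h5
      exact mul_le_mul_of_nonneg_left (by linarith) h1.le
    have hdep : (if 0 < n then μ₂ * (Real.exp (s * (1 + κ n)) - 1) else 0)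
        ≤ μ₂ * (s * (1 + κ n) + s ^ 2 * H ^ 2) := by
      have h6 : 0 ≤ 1 + κ n := by linarith [hκ0 n]
      split_ifs
      · obtain ⟨h3, h4⟩ := hbound (1 + κ n) h6 (hκH n)
        have h5 := exp_sub_one_le h4
        exact mul_le_mul_of_nonneg_left (by linarith) h2.le
      · positivity
    have hs2 : s ^ 2 * Q ≤ s * ε := by nlinarith
    have hℓs : ℓ * s ^ 2 ≤ (μ₂ + 2 * ε) * s ^ 2 := mul_le_mul_of_nonneg_right hℓle (sq_nonneg s)
    have hQs : s ^ 2 * Q = (μ₂ + 2 * ε) * s ^ 2 + μ₁ * (s ^ 2 * H ^ 2) + μ₂ * (s ^ 2 * H ^ 2) := by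
      rw [hQ]; ring
    rcases Nat.eq_zero_or_pos a with rfl | ha
    · have hn : n₁ < n := by
        by_contra! h
        exact hx ⟨rfl, h⟩
      have hκn : κ n = 0 := hκ1 n hn.le
      have hℓn : ℓ = μ₂ + 2 * ε := by rw [hℓ, if_neg (by omega)]
      rw [hκn] at hdep
      have hnn : 0 ≤ μ₁ * (s ^ 2 * H ^ 2) := by positivity
      have hsε : 0 < s * ε := mul_pos hs0 hε
      simp only [lt_self_iff_false, if_false, add_zero]
      rw [hκn]
      rw [hℓn] at harr
      linarith
    · rw [if_pos ha]
      have hdrift := le_add_mul_slopeExcess_sub (n₀ := n₀) hμ₂ hμ hε n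
      rw [← hκdef, ← hℓ] at hdrift
      have := mul_le_mul_of_nonneg_left hdrift hs0.le
      linarith
  · refine Real.exp_lt_one_iff.2 ?_
    have : g 0 = 0 := by simp [hg]
    rw [this, add_zero]
    exact mul_neg_of_pos_of_neg hs0 (sub_neg.2 hm)

end Instability

/-! ### Means of truncated geometric distributions -/

section GeometricMean

variable {lam : ℕ → ℝ≥0} {μ₁ μ₂ : ℝ≥0}

theorem truncGeomMean_eq (lam : ℕ → ℝ≥0) (n : ℕ) (z : ℝ≥0) :
    truncGeomMean lam n z
      = (((∑ j ∈ Finset.range (n + 1), z ^ j * lam j) / ∑ j ∈ Finset.range (n + 1), z ^ j : ℝ≥0)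
          : ℝ≥0∞) := by
  have hT : ∑ j ∈ Finset.range (n + 1), z ^ j ≠ 0 := by
    rw [Finset.sum_range_succ']
    simp
  have hsum : ∀ f : ℕ → ℝ≥0∞, ∑' j, (if j ≤ n then (z : ℝ≥0∞) ^ j else 0) * f j
      = ∑ j ∈ Finset.range (n + 1), (z : ℝ≥0∞) ^ j * f j := by
    intro f
    rw [tsum_eq_sum (s := Finset.range (n + 1)) fun j hj => by
      rw [if_neg (by simpa [Nat.lt_succ_iff] using hj), zero_mul]]
    refine Finset.sum_congr rfl fun j hj => ?_
    rw [if_pos (Nat.lt_succ_iff.1 (Finset.mem_range.1 hj))]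
  have h1 := hsum 1
  simp only [Pi.one_apply, mul_one] at h1
  rw [truncGeomMean, lintegral_countable', ENNReal.coe_div hT, div_eq_mul_inv]
  push_cast
  rw [← h1, ← hsum, ← ENNReal.tsum_mul_right]
  refine tsum_congr fun j => ?_
  rw [PMF.toMeasure_apply_singleton _ _ (measurableSet_singleton j), truncGeom,
    PMF.normalize_apply]
  ring

theorem isStableTandem_of_limsup_lt (hlam : 0 < lam 0) (hμ₂ : 0 < μ₂) (hμ : μ₂ ≤ μ₁)
    (h : limsup (fun n => truncGeomMean lam n (μ₁ / μ₂)) atTop < (μ₂ : ℝ≥0∞)) :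
    IsStableTandem lam μ₁ μ₂ := by
  obtain ⟨d, hd1, hd2⟩ := ENNReal.lt_iff_exists_nnreal_btwn.1 h
  refine isStableTandem_of_geometric_mean hlam hμ₂ hμ d.coe_nonneg
    (by exact_mod_cast hd2) ?_
  filter_upwards [eventually_lt_of_limsup_lt hd1] with n hn
  have hT : 0 < ∑ j ∈ Finset.range (n + 1), (μ₁ / μ₂) ^ j := by
    rw [Finset.sum_range_succ']
    simp
  rw [truncGeomMean_eq, ENNReal.coe_lt_coe, div_lt_iff₀ hT] at hn
  have := NNReal.coe_le_coe.2 hn.le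
  push_cast at this
  exact this

/-- Weights which do not decrease give no mass to finitely many levels in the limit. -/
theorem limsup_truncGeomMean_le {z : ℝ≥0} (hz : 1 ≤ z) {c : ℝ≥0} {n₀ : ℕ}
    (hc : ∀ n, n₀ ≤ n → lam n ≤ c) : limsup (fun n => truncGeomMean lam n z) atTop ≤ c := by
  set K : ℝ≥0 := ∑ j ∈ Finset.range n₀, z ^ j * lam j with hK
  have hle : ∀ n, truncGeomMean lam n z ≤ ((K / (n + 1 : ℕ) + c : ℝ≥0) : ℝ≥0∞) := by
    intro n
    rw [truncGeomMean_eq, ENNReal.coe_le_coe]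
    have hT : ((n + 1 : ℕ) : ℝ≥0) ≤ ∑ j ∈ Finset.range (n + 1), z ^ j := by
      calc ((n + 1 : ℕ) : ℝ≥0) = ∑ j ∈ Finset.range (n + 1), (1 : ℝ≥0) := by simp
        _ ≤ _ := Finset.sum_le_sum fun j _ => one_le_pow₀ hz
    have hT0 : 0 < ∑ j ∈ Finset.range (n + 1), z ^ j :=
      lt_of_lt_of_le (by positivity) hT
    have hA : ∑ j ∈ Finset.range (n + 1), z ^ j * lam j
        ≤ K + c * ∑ j ∈ Finset.range (n + 1), z ^ j := by
      have hterm : ∀ j, z ^ j * lam j ≤ (if j < n₀ then z ^ j * lam j else 0) + c * z ^ j := by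
        intro j
        split_ifs with hj
        · exact le_self_add
        · rw [zero_add, mul_comm]
          gcongr
          exact hc j (not_lt.1 hj)
      refine (Finset.sum_le_sum fun j _ => hterm j).trans ?_
      rw [Finset.sum_add_distrib, ← Finset.mul_sum, ← Finset.sum_filter]
      gcongr
      refine Finset.sum_le_sum_of_subset fun j hj => ?_
      exact Finset.mem_range.2 (Finset.mem_filter.1 hj).2
    calc _ ≤ (K + c * ∑ j ∈ Finset.range (n + 1), z ^ j) / ∑ j ∈ Finset.range (n + 1), z ^ j := by
          gcongr
      _ = K / ∑ j ∈ Finset.range (n + 1), z ^ j + c := by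
          rw [add_div, mul_div_cancel_right₀ _ hT0.ne']
      _ ≤ _ := by gcongr
  have hlim : Tendsto (fun n : ℕ => ((K / (n + 1 : ℕ) + c : ℝ≥0) : ℝ≥0∞)) atTop (𝓝 c) := by
    rw [ENNReal.tendsto_coe]
    have h0 : Tendsto (fun n : ℕ => K / ((n + 1 : ℕ) : ℝ≥0)) atTop (𝓝 0) := by
      rw [← NNReal.tendsto_coe]
      push_cast
      exact_mod_cast (tendsto_const_div_atTop_nhds_zero_nat (K : ℝ)).comp (tendsto_add_atTop_nat 1)
    simpa using h0.add_const c
  exact (limsup_le_limsup (Eventually.of_forall hle)).trans hlim.limsup_eq.le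

theorem not_isStableTandem_of_lt_liminf (hlam : 0 < lam 0) (hμ₂ : 0 < μ₂) (hμ : μ₂ ≤ μ₁)
    (h : (μ₂ : ℝ≥0∞) < liminf (fun n => (lam n : ℝ≥0∞)) atTop) : ¬ IsStableTandem lam μ₁ μ₂ := by
  obtain ⟨d, hd1, hd2⟩ := ENNReal.lt_iff_exists_nnreal_btwn.1 h
  have hd : (μ₂ : ℝ) < d := by exact_mod_cast hd1
  obtain ⟨n₀, hn₀⟩ := eventually_atTop.1 (eventually_lt_of_lt_liminf hd2)
  refine not_isStableTandem_of_eventually_le hlam hμ₂ hμ (ε := (d - μ₂) / 2) (n₀ := n₀)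
    (by linarith) fun n hn => ?_
  have : (d : ℝ) < lam n := by exact_mod_cast hn₀ n hn
  linarith

end GeometricMean

theorem mainTheorem3 (lam : ℕ → ℝ≥0) (μ₁ μ₂ : ℝ≥0) (hlam : 0 < lam 0) (hμ₂ : 0 < μ₂)
    (hμ : μ₂ ≤ μ₁) :
    (limsup (fun n => truncGeomMean lam n (μ₁ / μ₂)) atTop < (μ₂ : ℝ≥0∞) →
      IsStableTandem lam μ₁ μ₂) ∧
    ((μ₂ : ℝ≥0∞) < liminf (fun n => (lam n : ℝ≥0∞)) atTop →
      ¬ IsStableTandem lam μ₁ μ₂) ∧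
    (∀ l : ℝ≥0∞, Tendsto (fun n => (lam n : ℝ≥0∞)) atTop (𝓝 l) →
      (l < (μ₂ : ℝ≥0∞) → IsStableTandem lam μ₁ μ₂) ∧
      ((μ₂ : ℝ≥0∞) < l → ¬ IsStableTandem lam μ₁ μ₂)) := by
  refine ⟨isStableTandem_of_limsup_lt hlam hμ₂ hμ, not_isStableTandem_of_lt_liminf hlam hμ₂ hμ,
    fun l hl => ⟨fun h => ?_, fun h => ?_⟩⟩
  · obtain ⟨c, hc1, hc2⟩ := ENNReal.lt_iff_exists_nnreal_btwn.1 h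
    obtain ⟨n₀, hn₀⟩ := eventually_atTop.1 (hl.eventually_lt_const hc1)
    have hz : 1 ≤ μ₁ / μ₂ := (one_le_div hμ₂).2 hμ
    exact isStableTandem_of_limsup_lt hlam hμ₂ hμ
      ((limsup_truncGeomMean_le hz fun n hn => by exact_mod_cast (hn₀ n hn).le).trans_lt hc2)
  · exact not_isStableTandem_of_lt_liminf hlam hμ₂ hμ (hl.liminf_eq.symm ▸ h)
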